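/- Let $G$ be a finite-dimensional real Lie group with Lie algebra $\mathfrak g$ (bracket of left-invariant vector fields, $\mathrm{ad}_\xi\eta=[\xi,\eta]$). For a map $h$ from $G$ to a finite-dimensional real vector space, let $D_gh(g)\cdot\eta=\frac{d}{ds}\big|_{s=0}h(g\exp(s\eta))$ for $\eta\in\mathfrak g$. Let $T_0\le\tau_0<T_N$, let $f_1,f_2:G\times[T_0,T_N]\to\mathfrak g$ be $C^1$ modes, let $L:G\to\mathbb R$ be $C^1$ and $\varphi:G\to\mathbb R$ differentiable, and fix an initial state $x_0\in G$. For $\lambda\ge 0$ put $$f(g,\lambda;t)=\begin{cases} f_2(g;t), & \tau_0\le t<\tau_0+\lambda,\\ f_1(g;t), & \text{otherwise,}\end{cases}$$ and suppose that for all sufficiently small $\lambda\ge0$ the curve $g_\lambda:[T_0,T_N]\to G$ is the trajectory of the switched system $\dot g(t)=g(t)\,f(g(t),\lambda;t)$ with $g_\lambda(T_0)=x_0$ (continuous on $[T_0,T_N]$; at switching times $\dot g$ means the right derivative). Let $$J(\lambda)=\int_{T_0}^{T_N}L(g_\lambda(t))\,dt+\varphi(g_\lambda(T_N)),$$ and write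 $g=g_\lambda|_{\lambda=0}$ for the nominal trajectory. Then the costate equation $$\dot\rho(s)^T=-\rho(s)^T\big(D_gf_1(g(s);s)-\mathrm{ad}_{f_1(g(s);s)}\big)-D_gL(g(s)),\qquad s\in[T_0,T_N],\qquad \rho(T_N)=D_g\varphi(g(T_N)),$$ has a solution $\rho:[T_0,T_N]\to\mathfrak g^*$, and for every such $\rho$ the right derivative of $J$ at $\lambda=0$ exists and equals $$\frac{dJ}{d\lambda}\Big|_{\lambda=0^+}=\lim_{\lambda\to0^+}\frac{J(\lambda)-J(0)}{\lambda}=\rho(\tau_0)^T\big[f_2(g(\tau_0);\tau_0)-f_1(g(\tau_0);\tau_0)\big].$$ -/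

import Mathlib

open Set Filter Topology MeasureTheory
open scoped Manifold ContDiff

namespace LieSwitch

section Exponential

/-- The one-parameter subgroup with velocity `η`: the left-invariant vector field generated by
`η` has an integral curve through the identity which is defined for all times. -/
theorem exists_integralCurve {E : Type*} [NormedAddCommGroup E] [NormedSpace ℝ E]
    [FiniteDimensional ℝ E] {G : Type*} [TopologicalSpace G] [ChartedSpace E G] [Group G]
    [LieGroup 𝓘(ℝ, E) ∞ G] [T2Space G] (η : GroupLieAlgebra 𝓘(ℝ, E) G) :
    ∃ γ : ℝ → G, γ 0 = 1 ∧
      IsMIntegralCurve (I := 𝓘(ℝ, E)) γ (mulInvariantVectorField (I := 𝓘(ℝ, E)) η) := by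
  have h3 : LieGroup 𝓘(ℝ, E) (minSmoothness ℝ 3) G :=
    LieGroup.of_le (n := ∞) (by
      rw [minSmoothness_of_isRCLikeNormedField]; exact WithTop.coe_le_coe.2 (le_top : (3 : ℕ∞) ≤ ⊤))
  have : IsManifold 𝓘(ℝ, E) 1 G := IsManifold.of_le (n := ∞) (mod_cast le_top)
  have : CompleteSpace E := FiniteDimensional.complete ℝ E
  have hv : ContMDiff 𝓘(ℝ, E) 𝓘(ℝ, E).tangent 1
      (fun g : G => (mulInvariantVectorField (I := 𝓘(ℝ, E)) η g : TangentBundle 𝓘(ℝ, E) G)) :=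
    (contMDiff_mulInvariantVectorField η).of_le (by simp)
  obtain ⟨γ, h0, hγ⟩ := exists_isMIntegralCurveAt_of_contMDiffAt_boundaryless (I := 𝓘(ℝ, E)) 0
    (hv.contMDiffAt (x := (1 : G)))
  obtain ⟨ε, hε, hγ⟩ := isMIntegralCurveAt_iff'.1 hγ
  refine exists_isMIntegralCurve_of_isMIntegralCurveOn hv hε (fun x => ?_) 1
  refine ⟨fun t => x * γ t, by simp [h0], fun t ht => ?_⟩
  have hb : Metric.ball (0 : ℝ) ε = Ioo (-ε) ε := by simp [Real.ball_eq_Ioo]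
  have hd := hγ t (hb ▸ ht)
  have hx : HasMFDerivAt 𝓘(ℝ, E) 𝓘(ℝ, E) (fun y : G => x * y) (γ t)
      (mfderiv 𝓘(ℝ, E) 𝓘(ℝ, E) (fun y : G => x * y) (γ t)) :=
    ((contMDiff_mul_left (I := 𝓘(ℝ, E)) (n := ∞) (a := x)).mdifferentiable
      (by simp)).mdifferentiableAt.hasMFDerivAt
  have hc := hx.comp_hasMFDerivWithinAt t hd
  rw [hb] at hc
  have key : mulInvariantVectorField (I := 𝓘(ℝ, E)) η (x * γ t) =
      mfderiv 𝓘(ℝ, E) 𝓘(ℝ, E) (fun y : G => x * y) (γ t)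
        (mulInvariantVectorField (I := 𝓘(ℝ, E)) η (γ t)) := ?_
  · rw [key]
    have hlin : (1 : ℝ →L[ℝ] ℝ).smulRight (mfderiv 𝓘(ℝ, E) 𝓘(ℝ, E) (fun y : G => x * y) (γ t)
        (mulInvariantVectorField (I := 𝓘(ℝ, E)) η (γ t)) : E) =
        (mfderiv 𝓘(ℝ, E) 𝓘(ℝ, E) (fun y : G => x * y) (γ t) : E →L[ℝ] E).comp
          ((1 : ℝ →L[ℝ] ℝ).smulRight
            (mulInvariantVectorField (I := 𝓘(ℝ, E)) η (γ t) : E)) := by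
      ext
      simp
    exact hlin ▸ hc
  · have h1 : HasMFDerivAt 𝓘(ℝ, E) 𝓘(ℝ, E) (fun y : G => γ t * y) 1
        (mfderiv 𝓘(ℝ, E) 𝓘(ℝ, E) (fun y : G => γ t * y) 1) :=
      ((contMDiff_mul_left (I := 𝓘(ℝ, E)) (n := ∞) (a := γ t)).mdifferentiable
        (by simp)).mdifferentiableAt.hasMFDerivAt
    have h2 : HasMFDerivAt 𝓘(ℝ, E) 𝓘(ℝ, E) (fun y : G => x * y) (γ t * 1)
        (mfderiv 𝓘(ℝ, E) 𝓘(ℝ, E) (fun y : G => x * y) (γ t) : E →L[ℝ] E) := by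
      rw [mul_one]; exact hx
    have hmul : (fun y : G => x * γ t * y) = (fun y : G => x * y) ∘ (fun y : G => γ t * y) := by
      funext y; simp [mul_assoc]
    have h12 := (h2.comp 1 h1).mfderiv
    rw [← hmul] at h12
    exact congrArg (fun A : E →L[ℝ] E => A η) h12

/-- The exponential map of the Lie group `G`: the time-one value of the integral curve through
the identity of the left-invariant vector field generated by `η`. -/
noncomputable def lieExp {E : Type*} [NormedAddCommGroup E] [NormedSpace ℝ E]
    [FiniteDimensional ℝ E] {G : Type*} [TopologicalSpace G] [ChartedSpace E G] [Group G]
    [LieGroup 𝓘(ℝ, E) ∞ G] [T2Space G] (η : GroupLieAlgebra 𝓘(ℝ, E) G) : G :=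
  (exists_integralCurve η).choose 1

/-- The exponential map does not depend on the choice of the integral curve. -/
theorem lieExp_eq {E : Type*} [NormedAddCommGroup E] [NormedSpace ℝ E]
    [FiniteDimensional ℝ E] {G : Type*} [TopologicalSpace G] [ChartedSpace E G] [Group G]
    [LieGroup 𝓘(ℝ, E) ∞ G] [T2Space G] (η : GroupLieAlgebra 𝓘(ℝ, E) G) (γ : ℝ → G)
    (h0 : γ 0 = 1)
    (hγ : IsMIntegralCurve (I := 𝓘(ℝ, E)) γ (mulInvariantVectorField (I := 𝓘(ℝ, E)) η)) :
    lieExp η = γ 1 := by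
  have h3 : LieGroup 𝓘(ℝ, E) (minSmoothness ℝ 3) G :=
    LieGroup.of_le (n := ∞) (by
      rw [minSmoothness_of_isRCLikeNormedField]; exact WithTop.coe_le_coe.2 (le_top : (3 : ℕ∞) ≤ ⊤))
  have : IsManifold 𝓘(ℝ, E) 1 G := IsManifold.of_le (n := ∞) (mod_cast le_top)
  have hv : ContMDiff 𝓘(ℝ, E) 𝓘(ℝ, E).tangent 1
      (fun g : G => (mulInvariantVectorField (I := 𝓘(ℝ, E)) η g : TangentBundle 𝓘(ℝ, E) G)) :=
    (contMDiff_mulInvariantVectorField η).of_le (by simp)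
  have hs := (exists_integralCurve η).choose_spec
  exact congrFun (isMIntegralCurve_Ioo_eq_of_contMDiff_boundaryless (t₀ := 0) hv hs.2 hγ
    (hs.1.trans h0.symm)) 1

end Exponential

section Calculus

/-- The left-trivialized derivative `D_g f|_g · η = d/ds f (g exp (s η))` at `s = 0`. -/
noncomputable def leftDeriv {E : Type*} [NormedAddCommGroup E] [NormedSpace ℝ E]
    [FiniteDimensional ℝ E] {G : Type*} [TopologicalSpace G] [ChartedSpace E G] [Group G]
    [LieGroup 𝓘(ℝ, E) ∞ G] [T2Space G]
    {F : Type*} [AddCommGroup F] [Module ℝ F] [TopologicalSpace F]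
    (f : G → F) (g : G) (η : GroupLieAlgebra 𝓘(ℝ, E) G) : F :=
  deriv (fun s : ℝ => f (g * lieExp (s • η))) 0

end Calculus

section Switched

/-- The inserted system: mode `f₂` on `[τ₀, τ₀ + lam)`, mode `f₁` at all other times. -/
noncomputable def insertedMode {G V : Type*} (f₁ f₂ : G → ℝ → V) (τ₀ lam : ℝ) : G → ℝ → V :=
  open Classical in
  fun g t => if τ₀ ≤ t ∧ t < τ₀ + lam then f₂ g t else f₁ g t

/-- `g` is the trajectory on `[T₀, TN]`, starting at `g₀`, of the system `ġ = g ξ`,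
`ξ = f (g, t)`. The left translate `g ξ` is the value at `g` of the left-invariant field generated
by `ξ`. The curve is continuous, and at every time of `[T₀, TN)` its right derivative is the
prescribed one: the switched right-hand side is right-continuous in time (away from the
switching times this is the ordinary derivative). -/
structure IsTrajectory {E : Type*} [NormedAddCommGroup E] [NormedSpace ℝ E]
    {G : Type*} [TopologicalSpace G] [ChartedSpace E G] [Group G]
    (f : G → ℝ → GroupLieAlgebra 𝓘(ℝ, E) G) (T₀ TN : ℝ) (g₀ : G) (g : ℝ → G) : Prop where
  init : g T₀ = g₀
  cont : ContinuousOn g (Icc T₀ TN)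
  ode : ∀ t ∈ Ico T₀ TN, HasMFDerivWithinAt 𝓘(ℝ, ℝ) 𝓘(ℝ, E) g (Ici t) t
    ((1 : ℝ →L[ℝ] ℝ).smulRight (mulInvariantVectorField (I := 𝓘(ℝ, E)) (f (g t) t) (g t)))

/-- The objective `∫ L(g(t)) dt + φ(g(TN))` along a curve. -/
noncomputable def cost {G : Type*} (L φ : G → ℝ) (T₀ TN : ℝ) (g : ℝ → G) : ℝ :=
  (∫ t in T₀..TN, L (g t)) + φ (g TN)

/-- `ρ` is the costate on `[T₀, TN]` along the curve `g`:
`ρ̇ᵀ = -ρᵀ (D_g f - ad_f) - D_g L` and `ρ(TN) = D_g φ (g(TN))`, as equalities of linear forms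
on the Lie algebra. -/
structure IsCostate {E : Type*} [NormedAddCommGroup E] [NormedSpace ℝ E]
    [FiniteDimensional ℝ E] {G : Type*} [TopologicalSpace G] [ChartedSpace E G] [Group G]
    [LieGroup 𝓘(ℝ, E) ∞ G] [T2Space G]
    (f : G → ℝ → GroupLieAlgebra 𝓘(ℝ, E) G) (L φ : G → ℝ) (T₀ TN : ℝ) (g : ℝ → G)
    (ρ : ℝ → Module.Dual ℝ (GroupLieAlgebra 𝓘(ℝ, E) G)) : Prop where
  ode : ∀ s ∈ Icc T₀ TN, ∀ η : GroupLieAlgebra 𝓘(ℝ, E) G,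
    HasDerivWithinAt (fun t => ρ t η)
      (-(ρ s (leftDeriv (fun x => f x s) (g s) η - ⁅f (g s) s, η⁆)) - leftDeriv L (g s) η)
      (Icc T₀ TN) s
  terminal : ∀ η : GroupLieAlgebra 𝓘(ℝ, E) G, ρ TN η = leftDeriv φ (g TN) η

end Switched

end LieSwitch

/-!
Let `c = γ 0` be the nominal trajectory. For small `lam` the curve `c⁻¹ (γ lam)` stays close to the
identity, and in a chart there it solves an ordinary differential equation in a vector space. The
field `F₁` of mode `f₁` vanishes at the identity, with linearization `D_g f₁ - ad_{f₁}`: the bracket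
arises as the antisymmetric part of the second derivative of the multiplication. So the costate
equation is the adjoint equation of this linearization. Mode `f₂` acts only during a needle of
length `lam`, hence displaces the curve by `O(lam)`. The costate equation makes the derivative of
the Hamiltonian `ρ F₁ + L` at the identity equal to `-ρ̇`, so `ρ` applied to the displacement, plus
the excess running cost so far, changes at rate `ρ (f₂ - f₁) + o(1)` during the needle and only
`o(lam)` after it: it grows to `lam • ρ(τ₀) (f₂ - f₁) + o(lam)`. By the terminal condition its final
value is `J(lam) - J(0) + o(lam)`.
-/

namespace LieSwitch

section LinearODE

variable {V : Type*} [NormedAddCommGroup V] [NormedSpace ℝ V] {a b : ℝ}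

theorem hasDerivWithinAt_ite_le {c : ℝ} (hac : a ≤ c) (hcb : c ≤ b) {v : ℝ → V → V} {x y : ℝ → V}
    (hx : ∀ t ∈ Icc a c, HasDerivWithinAt x (v t (x t)) (Icc a c) t)
    (hy : ∀ t ∈ Icc c b, HasDerivWithinAt y (v t (y t)) (Icc c b) t) (hxy : x c = y c) :
    ∀ t ∈ Icc a b, HasDerivWithinAt (fun s => if s ≤ c then x s else y s)
      (v t (if t ≤ c then x t else y t)) (Icc a b) t := by
  intro t ht
  have hleft : EqOn (fun s => if s ≤ c then x s else y s) x (Icc a c) := fun s hs => if_pos hs.2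
  have hright : EqOn (fun s => if s ≤ c then x s else y s) y (Icc c b) := fun s hs => by
    rcases hs.1.eq_or_lt with rfl | hcs
    · simpa using hxy
    · exact if_neg hcs.not_ge
  have hIcc : Icc a b = Icc a c ∪ Icc c b := (Icc_union_Icc_eq_Icc hac hcb).symm
  rcases lt_trichotomy t c with htc | rfl | hct
  · have ht' : t ∈ Icc a c := ⟨ht.1, htc.le⟩
    rw [if_pos htc.le]
    exact ((hx t ht').congr_of_mem hleft ht').mono_of_mem_nhdsWithin
      (mem_nhdsWithin.2 ⟨Iio c, isOpen_Iio, htc, fun s hs => ⟨hs.2.1, hs.1.le⟩⟩)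
  · have hderivLeft := (hx t ⟨hac, le_rfl⟩).congr_of_mem hleft ⟨hac, le_rfl⟩
    have hderivRight := (hy t ⟨le_rfl, hcb⟩).congr_of_mem hright ⟨le_rfl, hcb⟩
    rw [if_pos le_rfl, hIcc]
    exact hderivLeft.union (hxy ▸ hderivRight)
  · have ht' : t ∈ Icc c b := ⟨hct.le, ht.2⟩
    rw [if_neg hct.not_ge]
    exact ((hy t ht').congr_of_mem hright ht').mono_of_mem_nhdsWithin
      (mem_nhdsWithin.2 ⟨Ioi c, isOpen_Ioi, hct, fun s hs => ⟨hs.1.le, hs.2.2⟩⟩)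

variable [CompleteSpace V] {A : ℝ → V →L[ℝ] V} {β : ℝ → V}

theorem exists_hasDerivWithinAt_affine_of_mul_le {K : ℝ} (hab : a ≤ b)
    (hA : ContinuousOn A (Icc a b)) (hβ : ContinuousOn β (Icc a b)) (hK : ∀ t ∈ Icc a b, ‖A t‖ ≤ K)
    (hshort : K * (b - a) ≤ 1 / 2) (v : V) :
    ∃ ρ : ℝ → V, ρ b = v ∧
      ∀ t ∈ Icc a b, HasDerivWithinAt ρ (A t (ρ t) + β t) (Icc a b) t := by
  obtain ⟨B, hB⟩ := isCompact_Icc.exists_bound_of_continuousOn hβ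
  have hb : b ∈ Icc a b := right_mem_Icc.2 hab
  have hK0 : 0 ≤ K := (norm_nonneg _).trans (hK b hb)
  have hB0 : 0 ≤ B := (norm_nonneg _).trans (hB b hb)
  have hba : 0 ≤ b - a := sub_nonneg.2 hab
  lift K to NNReal using hK0
  let R : NNReal := ⟨‖v‖ + 2 * (B * (b - a)), by positivity⟩
  let N : NNReal := ⟨K * (‖v‖ + R) + B, by positivity⟩
  have hPicard : IsPicardLindelof (fun t x => A t x + β t) (⟨b, hb⟩ : Icc a b) v R 0 N K :=
    { lipschitzOnWith := fun t ht => LipschitzOnWith.of_dist_le_mul fun x _ y _ => by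
        rw [dist_add_right, dist_eq_norm, ← map_sub, dist_eq_norm]
        exact (A t).le_of_opNorm_le (hK t ht) _
      continuousOn := fun x _ => (hA.clm_apply continuousOn_const).add hβ
      norm_le := fun t ht x hx => by
        have hx' : ‖x‖ ≤ ‖v‖ + R := norm_le_norm_add_const_of_dist_le hx
        exact (norm_add_le _ _).trans (add_le_add
          (((A t).le_of_opNorm_le (hK t ht) x).trans (by gcongr)) (hB t ht))
      mul_max_le := by
        change (K * (‖v‖ + (‖v‖ + 2 * (B * (b - a)))) + B) * max (b - b) (b - a) ≤
          ‖v‖ + 2 * (B * (b - a)) - 0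
        rw [sub_self, max_eq_right hba]
        nlinarith [norm_nonneg v, mul_nonneg hB0 hba] }
  exact hPicard.exists_eq_forall_mem_Icc_hasDerivWithinAt₀

theorem exists_hasDerivWithinAt_affine (hab : a ≤ b) (hA : ContinuousOn A (Icc a b))
    (hβ : ContinuousOn β (Icc a b)) (v : V) :
    ∃ ρ : ℝ → V, ρ b = v ∧
      ∀ t ∈ Icc a b, HasDerivWithinAt ρ (A t (ρ t) + β t) (Icc a b) t := by
  obtain ⟨K, hK⟩ := isCompact_Icc.exists_bound_of_continuousOn hA
  have hK0 : 0 ≤ K := (norm_nonneg _).trans (hK b (right_mem_Icc.2 hab))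
  obtain ⟨n, hn⟩ := exists_nat_ge (2 * (K * (b - a)))
  induction n generalizing a with
  | zero =>
    exact exists_hasDerivWithinAt_affine_of_mul_le hab hA hβ hK
      (by rw [Nat.cast_zero] at hn; linarith) v
  | succ n ih =>
    let c := a + (b - a) / (n + 1)
    have hca : (n + 1) * (c - a) = b - a := by simp only [c]; field_simp; ring
    have hac : a ≤ c := le_add_of_nonneg_right (div_nonneg (sub_nonneg.2 hab) (by positivity))
    have hcb : c ≤ b := by nlinarith
    have hleft : Icc a c ⊆ Icc a b := Icc_subset_Icc_right hcb
    have hright : Icc c b ⊆ Icc a b := Icc_subset_Icc_left hac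
    have hshort : K * (c - a) ≤ 1 / 2 := by
      push_cast at hn
      rw [← hca] at hn
      nlinarith
    obtain ⟨y, hyb, hy⟩ := ih hcb (hA.mono hright) (hβ.mono hright) (fun t ht => hK t (hright ht))
      (by push_cast at hn; nlinarith)
    obtain ⟨x, hxc, hx⟩ := exists_hasDerivWithinAt_affine_of_mul_le hac (hA.mono hleft)
      (hβ.mono hleft) (fun t ht => hK t (hleft ht)) hshort (y c)
    refine ⟨fun s => if s ≤ c then x s else y s, ?_,
      hasDerivWithinAt_ite_le hac hcb (v := fun t z => A t z + β t) hx hy hxc⟩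
    change (if b ≤ c then x b else y b) = v
    split_ifs with hbc
    · rw [le_antisymm hbc hcb, hxc, le_antisymm hcb hbc, hyb]
    · exact hyb

end LinearODE

section UniformDifferentiability

variable {X V T : Type*} [NormedAddCommGroup X] [NormedSpace ℝ X] [NormedAddCommGroup V]
  [NormedSpace ℝ V]

/-- `D t` is the derivative of `x ↦ P x t` at `e`, uniformly over `t ∈ S`. -/
def HasUniformFDerivAt (P : X → T → V) (D : T → X →L[ℝ] V) (e : X) (S : Set T) : Prop :=
  ∀ ε > 0, ∀ᶠ x in 𝓝 e, ∀ t ∈ S, ‖P x t - P e t - D t (x - e)‖ ≤ ε * ‖x - e‖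

variable {P P' : X → T → V} {D D' : T → X →L[ℝ] V} {e : X} {S : Set T}

namespace HasUniformFDerivAt

theorem add (h : HasUniformFDerivAt P D e S) (h' : HasUniformFDerivAt P' D' e S) :
    HasUniformFDerivAt (fun x t => P x t + P' x t) (fun t => D t + D' t) e S := by
  intro ε hε
  filter_upwards [h (ε / 2) (half_pos hε), h' (ε / 2) (half_pos hε)] with x hx hx' t ht
  calc ‖P x t + P' x t - (P e t + P' e t) - (D t + D' t) (x - e)‖
      = ‖(P x t - P e t - D t (x - e)) + (P' x t - P' e t - D' t (x - e))‖ := by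
        rw [add_apply]; congr 1; abel
    _ ≤ ε / 2 * ‖x - e‖ + ε / 2 * ‖x - e‖ := norm_add_le_of_le (hx t ht) (hx' t ht)
    _ = ε * ‖x - e‖ := by ring

theorem clm_apply {W : Type*} [NormedAddCommGroup W] [NormedSpace ℝ W] {ρ : T → V →L[ℝ] W} {C : ℝ}
    (hρ : ∀ t ∈ S, ‖ρ t‖ ≤ C) (h : HasUniformFDerivAt P D e S) :
    HasUniformFDerivAt (fun x t => ρ t (P x t)) (fun t => (ρ t).comp (D t)) e S := by
  intro ε hε
  have hC : 0 < |C| + 1 := by positivity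
  filter_upwards [h (ε / (|C| + 1)) (div_pos hε hC)] with x hx t ht
  have hρt : ‖ρ t‖ ≤ |C| + 1 := by linarith [hρ t ht, le_abs_self C]
  calc ‖ρ t (P x t) - ρ t (P e t) - (ρ t).comp (D t) (x - e)‖
      = ‖ρ t (P x t - P e t - D t (x - e))‖ := by
        simp only [ContinuousLinearMap.comp_apply, map_sub]
    _ ≤ (|C| + 1) * (ε / (|C| + 1) * ‖x - e‖) := (ρ t).le_of_opNorm_le_of_le hρt (hx t ht)
    _ = ε * ‖x - e‖ := by field_simp

variable [TopologicalSpace T]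

theorem exists_norm_sub_le (h : HasUniformFDerivAt P D e S) (hS : IsCompact S)
    (hD : ContinuousOn D S) :
    ∃ K ≥ 0, ∀ᶠ x in 𝓝 e, ∀ t ∈ S, ‖P x t - P e t‖ ≤ K * ‖x - e‖ := by
  obtain ⟨C, hC⟩ := hS.exists_bound_of_continuousOn hD
  refine ⟨|C| + 1, by positivity, ?_⟩
  filter_upwards [h 1 one_pos] with x hx t ht
  calc ‖P x t - P e t‖ = ‖D t (x - e) + (P x t - P e t - D t (x - e))‖ := by congr 1; abel
    _ ≤ |C| * ‖x - e‖ + 1 * ‖x - e‖ :=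
        norm_add_le_of_le ((D t).le_of_opNorm_le ((hC t ht).trans (le_abs_self C)) _) (hx t ht)
    _ = (|C| + 1) * ‖x - e‖ := by ring

end HasUniformFDerivAt

theorem hasUniformFDerivAt_of_continuousOn [TopologicalSpace T] {D : X → T → X →L[ℝ] V} {U : Set X}
    (hU : U ∈ 𝓝 e) (hS : IsCompact S)
    (hD : ∀ y ∈ U, ∀ t ∈ S, HasFDerivAt (fun x => P x t) (D y t) y)
    (hcont : ContinuousOn D.uncurry (U ×ˢ S)) : HasUniformFDerivAt P (D e) e S := by
  intro ε hε
  obtain ⟨v, hv, hvD⟩ := hS.mem_uniformity_of_prod hcont (mem_of_mem_nhds hU)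
    (Metric.dist_mem_uniformity hε)
  rw [nhdsWithin_eq_nhds.2 hU] at hv
  obtain ⟨r, hr, hball⟩ := Metric.mem_nhds_iff.1 (inter_mem hU hv)
  filter_upwards [Metric.ball_mem_nhds e hr] with x hx t ht
  refine (convex_ball e r).norm_image_sub_le_of_norm_hasFDerivWithin_le'
    (fun y hy => (hD y (hball hy).1 t ht).hasFDerivWithinAt) (fun y hy => ?_)
    (Metric.mem_ball_self hr) hx
  rw [← dist_eq_norm]
  exact (hvD y (hball hy).2 t ht).le

end UniformDifferentiability

theorem exists_forall_lt_add_of_continuousWithinAt {X V : Type*} [TopologicalSpace X]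
    [PseudoMetricSpace V] {Q : X → ℝ → V} {e : X} {τ b : ℝ}
    (hQ : ContinuousWithinAt Q.uncurry (univ ×ˢ Icc τ b) (e, τ)) {ε : ℝ} (hε : 0 < ε) :
    ∃ δ > 0, ∀ᶠ x in 𝓝 e, ∀ t ∈ Icc τ b, t < τ + δ → dist (Q x t) (Q e τ) ≤ ε := by
  rw [ContinuousWithinAt, nhdsWithin_prod_eq, nhdsWithin_univ] at hQ
  obtain ⟨p, hp, q, hq, hpq⟩ := eventually_prod_iff.1 (hQ (Metric.closedBall_mem_nhds _ hε))
  obtain ⟨δ, hδ, hball⟩ := Metric.mem_nhdsWithin_iff.1 hq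
  refine ⟨δ, hδ, hp.mono fun x hx t ht htδ => hpq hx (hball ⟨?_, ht⟩)⟩
  rw [Real.ball_eq_Ioo]
  exact ⟨by linarith [ht.1], htδ⟩

theorem mapsTo_Icc_of_forall_mapsTo_Ico {Y : Type*} [TopologicalSpace Y] {h : ℝ → Y} {a b : ℝ}
    {C W : Set Y} (hC : IsClosed C) (hW : IsOpen W) (hCW : C ⊆ W) (hh : ContinuousOn h (Icc a b))
    (ha : h a ∈ W) (htrap : ∀ c ∈ Icc a b, MapsTo h (Ico a c) W → MapsTo h (Ico a c) C) :
    MapsTo h (Icc a b) W := by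
  by_contra hexit
  obtain ⟨t, ht, htW⟩ := not_subset.1 hexit
  have hclosed : IsClosed (Icc a b ∩ h ⁻¹' Wᶜ) :=
    hh.preimage_isClosed_of_isClosed isClosed_Icc hW.isClosed_compl
  obtain ⟨c, ⟨hc, hcW⟩, hleast⟩ :=
    (isCompact_Icc.of_isClosed_subset hclosed inter_subset_left).exists_isLeast ⟨t, ht, htW⟩
  have hac : a < c := hc.1.lt_of_ne fun h => hcW (h ▸ ha)
  have hIco : MapsTo h (Ico a c) C := htrap c hc fun s hs => by
    by_contra hsW
    exact hs.2.not_ge (hleast ⟨⟨hs.1, hs.2.le.trans hc.2⟩, hsW⟩)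
  have hlim : Tendsto h (𝓝[Ico a c] c) (𝓝 (h c)) :=
    (hh c hc).mono fun s hs => ⟨hs.1, hs.2.le.trans hc.2⟩
  have : (𝓝[Ico a c] c).NeBot := right_nhdsWithin_Ico_neBot hac
  exact hcW (hCW (hC.mem_of_tendsto hlim (eventually_mem_nhdsWithin.mono hIco)))

section Needle

theorem insertedMode_of_lt {G V : Type*} {f₁ f₂ : G → ℝ → V} {τ lam t : ℝ} (hτ : τ ≤ t)
    (ht : t < τ + lam) (g : G) : insertedMode f₁ f₂ τ lam g t = f₂ g t :=
  if_pos ⟨hτ, ht⟩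

theorem insertedMode_of_ge {G V : Type*} {f₁ f₂ : G → ℝ → V} {τ lam t : ℝ} (ht : τ + lam ≤ t)
    (g : G) : insertedMode f₁ f₂ τ lam g t = f₁ g t :=
  if_neg fun h => ht.not_gt h.2

theorem insertedMode_zero {G V : Type*} (f₁ f₂ : G → ℝ → V) (τ : ℝ) :
    insertedMode f₁ f₂ τ 0 = f₁ := by
  funext g t
  exact if_neg fun h => (h.1.trans_lt h.2).ne (add_zero τ).symm

variable {X : Type*} [NormedAddCommGroup X] [NormedSpace ℝ X]

/-- `x` solves on `[τ, b]` the system in a vector space which starts at `e` in mode `F₂` and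
switches to mode `F₁` at time `τ + lam`. -/
structure IsNeedleCurve (F₁ F₂ : X → ℝ → X) (τ b lam : ℝ) (e : X) (x : ℝ → X) : Prop where
  init : x τ = e
  cont : ContinuousOn x (Icc τ b)
  ode : ∀ t ∈ Ico τ b, HasDerivWithinAt x (insertedMode F₁ F₂ τ lam (x t) t) (Ici t) t

variable {F₁ F₂ : X → ℝ → X} {τ b lam : ℝ} {e : X}

namespace IsNeedleCurve

variable {x : ℝ → X}

theorem restrict {c : ℝ} (hx : IsNeedleCurve F₁ F₂ τ b lam e x) (hc : c ≤ b) :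
    IsNeedleCurve F₁ F₂ τ c lam e x where
  init := hx.init
  cont := hx.cont.mono (Icc_subset_Icc_right hc)
  ode t ht := hx.ode t ⟨ht.1, ht.2.trans_le hc⟩

theorem norm_sub_le_of_le {M t : ℝ} (hx : IsNeedleCurve F₁ F₂ τ b lam e x)
    (h₂ : ∀ s ∈ Ico τ b, s < τ + lam → ‖F₂ (x s) s‖ ≤ M) (ht : t ∈ Icc τ b) (htlam : t ≤ τ + lam) :
    ‖x t - e‖ ≤ M * (t - τ) := by
  have hxt := hx.restrict ht.2
  rw [← hx.init]
  refine norm_image_sub_le_of_norm_deriv_right_le_segment hxt.cont hxt.ode (fun s hs => ?_) t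
    (right_mem_Icc.2 ht.1)
  have hslam : s < τ + lam := hs.2.trans_le htlam
  rw [insertedMode_of_lt hs.1 hslam]
  exact h₂ s ⟨hs.1, hs.2.trans_le ht.2⟩ hslam

theorem norm_sub_le {K M : ℝ} (hx : IsNeedleCurve F₁ F₂ τ b lam e x) (hK : 0 ≤ K) (hM : 0 ≤ M)
    (hlam : 0 ≤ lam) (h₁ : ∀ t ∈ Ico τ b, ‖F₁ (x t) t‖ ≤ K * ‖x t - e‖)
    (h₂ : ∀ t ∈ Ico τ b, t < τ + lam → ‖F₂ (x t) t‖ ≤ M) {t : ℝ} (ht : t ∈ Icc τ b) :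
    ‖x t - e‖ ≤ M * lam * Real.exp (K * (t - τ)) := by
  have hexp : ∀ {s : ℝ}, 0 ≤ s → 1 ≤ Real.exp (K * s) := fun hs =>
    Real.one_le_exp (mul_nonneg hK hs)
  rcases le_total t (τ + lam) with htlam | htlam
  · calc ‖x t - e‖ ≤ M * (t - τ) := hx.norm_sub_le_of_le h₂ ht htlam
      _ ≤ M * lam := by gcongr; linarith
      _ ≤ M * lam * Real.exp (K * (t - τ)) :=
          le_mul_of_one_le_right (by positivity) (hexp (sub_nonneg.2 ht.1))
  · have hstart : ‖x (τ + lam) - e‖ ≤ M * lam := by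
      simpa using hx.norm_sub_le_of_le h₂ ⟨by linarith, htlam.trans ht.2⟩ le_rfl
    have hsub : ∀ s ∈ Ico (τ + lam) t, s ∈ Ico τ b := fun s hs =>
      ⟨by linarith [hs.1], hs.2.trans_le ht.2⟩
    have hgronwall := norm_le_gronwallBound_of_norm_deriv_right_le (f := fun s => x s - e)
      (f' := fun s => F₁ (x s) s) (ε := 0)
      ((hx.cont.mono (Icc_subset_Icc (by linarith) ht.2)).sub continuousOn_const)
      (fun s hs => by
        have hode := hx.ode s (hsub s hs)
        rw [insertedMode_of_ge hs.1] at hode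
        exact hode.sub_const e)
      hstart (fun s hs => by simpa using h₁ s (hsub s hs)) t (right_mem_Icc.2 htlam)
    rw [gronwallBound_ε0] at hgronwall
    refine hgronwall.trans ?_
    gcongr
    linarith

end IsNeedleCurve

theorem norm_sub_smul_le_of_needle {V : Type*} [NormedAddCommGroup V] [NormedSpace ℝ V]
    {W W' : ℝ → V} {q : V} {ε : ℝ} (hlam : 0 ≤ lam) (hb : τ + lam ≤ b) (h0 : W τ = 0)
    (hW : ContinuousOn W (Icc τ b)) (hW' : ∀ t ∈ Ico τ b, HasDerivWithinAt W (W' t) (Ici t) t)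
    (hneedle : ∀ t ∈ Ico τ (τ + lam), ‖W' t - q‖ ≤ ε)
    (hafter : ∀ t ∈ Ico (τ + lam) b, ‖W' t‖ ≤ ε * lam) :
    ‖W b - lam • q‖ ≤ ε * (1 + (b - τ)) * lam := by
  have hεlam : 0 ≤ ε * lam := by
    rcases hlam.eq_or_lt with rfl | hlam
    · simp
    · exact mul_nonneg ((norm_nonneg _).trans (hneedle τ ⟨le_rfl, by linarith⟩)) hlam.le
  have honNeedle : ‖W (τ + lam) - lam • q‖ ≤ ε * lam := by
    have hdeviation := norm_image_sub_le_of_norm_deriv_right_le_segment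
      (f := fun t => W t - (t - τ) • q) (f' := fun t => W' t - q) (a := τ) (b := τ + lam) (C := ε)
      ((hW.mono (Icc_subset_Icc_right hb)).sub (by fun_prop))
      (fun t ht => by
        have hlin : HasDerivWithinAt (fun t : ℝ => (t - τ) • q) q (Ici t) t := by
          simpa using ((hasDerivWithinAt_id t (Ici t)).sub_const τ).smul_const q
        exact (hW' t ⟨ht.1, ht.2.trans_le hb⟩).sub hlin)
      hneedle (τ + lam) (right_mem_Icc.2 (by linarith))
    simpa [h0] using hdeviation
  have hafterNeedle : ‖W b - W (τ + lam)‖ ≤ ε * lam * (b - (τ + lam)) :=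
    norm_image_sub_le_of_norm_deriv_right_le_segment (hW.mono (Icc_subset_Icc_left (by linarith)))
      (fun t ht => hW' t ⟨by linarith [ht.1], ht.2⟩) hafter b (right_mem_Icc.2 hb)
  calc ‖W b - lam • q‖ = ‖(W b - W (τ + lam)) + (W (τ + lam) - lam • q)‖ := by
        rw [sub_add_sub_cancel]
    _ ≤ ε * lam * (b - (τ + lam)) + ε * lam := norm_add_le_of_le hafterNeedle honNeedle
    _ ≤ ε * lam * (b - τ) + ε * lam := by gcongr; linarith
    _ = ε * (1 + (b - τ)) * lam := by ring

/-- A family of needle curves, indexed by the length `lam` of the needle, whose displacement from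
the base point `e` is at most `C * lam`. -/
structure IsNeedleVariation (F₁ F₂ : X → ℝ → X) (τ b : ℝ) (e : X) (x : ℝ → ℝ → X) (C : ℝ) :
    Prop where
  curve : ∀ᶠ lam in 𝓝[>] 0, IsNeedleCurve F₁ F₂ τ b lam e (x lam)
  norm_sub_le : ∀ᶠ lam in 𝓝[>] 0, ∀ t ∈ Icc τ b, ‖x lam t - e‖ ≤ C * lam

namespace IsNeedleVariation

variable {x : ℝ → ℝ → X} {C : ℝ}

theorem eventually_mapsTo (hx : IsNeedleVariation F₁ F₂ τ b e x C) {U : Set X} (hU : U ∈ 𝓝 e) :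
    ∀ᶠ lam in 𝓝[>] 0, ∀ t ∈ Icc τ b, x lam t ∈ U := by
  obtain ⟨r, hr, hball⟩ := Metric.mem_nhds_iff.1 hU
  have hsmall : Tendsto (fun lam : ℝ => C * lam) (𝓝[>] 0) (𝓝 0) :=
    ((continuous_const_mul C).tendsto' 0 0 (mul_zero C)).mono_left nhdsWithin_le_nhds
  filter_upwards [hx.norm_sub_le, hsmall.eventually_lt_const hr] with lam hlam hr t ht
  exact hball (mem_ball_iff_norm.2 ((hlam t ht).trans_lt hr))

theorem eventually_norm_remainder_le {V : Type*} [NormedAddCommGroup V] [NormedSpace ℝ V]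
    {P : X → ℝ → V} {D : ℝ → X →L[ℝ] V} (hx : IsNeedleVariation F₁ F₂ τ b e x C)
    (hP : HasUniformFDerivAt P D e (Icc τ b)) {ε : ℝ} (hε : 0 < ε) :
    ∀ᶠ lam in 𝓝[>] 0, ∀ t ∈ Icc τ b,
      ‖P (x lam t) t - P e t - D t (x lam t - e)‖ ≤ ε * lam := by
  have hC : 0 < |C| + 1 := by positivity
  filter_upwards [hx.eventually_mapsTo (hP (ε / (|C| + 1)) (div_pos hε hC)), hx.norm_sub_le,
    self_mem_nhdsWithin] with lam hP hnorm (hlam : 0 < lam) t ht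
  calc ‖P (x lam t) t - P e t - D t (x lam t - e)‖
      ≤ ε / (|C| + 1) * ‖x lam t - e‖ := hP t ht t ht
    _ ≤ ε / (|C| + 1) * ((|C| + 1) * lam) := by
        gcongr
        exact (hnorm t ht).trans (by gcongr; linarith [le_abs_self C])
    _ = ε * lam := by field_simp

theorem eventually_norm_sub_le_of_needle {V : Type*} [NormedAddCommGroup V] {Q : X → ℝ → V}
    (hx : IsNeedleVariation F₁ F₂ τ b e x C) (hτ : τ < b)
    (hQ : ContinuousWithinAt Q.uncurry (univ ×ˢ Icc τ b) (e, τ)) {ε : ℝ} (hε : 0 < ε) :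
    ∀ᶠ lam in 𝓝[>] 0, ∀ t ∈ Ico τ (τ + lam), ‖Q (x lam t) t - Q e τ‖ ≤ ε := by
  obtain ⟨δ, hδ, hclose⟩ := exists_forall_lt_add_of_continuousWithinAt hQ hε
  filter_upwards [hx.eventually_mapsTo hclose, nhdsWithin_le_nhds (Iio_mem_nhds hδ),
    nhdsWithin_le_nhds (Iio_mem_nhds (sub_pos.2 hτ))] with lam hclose (hlamδ : lam < δ)
    (hlamb : lam < b - τ) t ht
  have htb : t ∈ Icc τ b := ⟨ht.1, by linarith [ht.2]⟩
  rw [← dist_eq_norm]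
  exact hclose t htb t htb (by linarith [ht.2])

theorem isLittleO_comp {V : Type*} [NormedAddCommGroup V] [NormedSpace ℝ V] {Φ : X → V}
    {Φ' : X →L[ℝ] V} (hx : IsNeedleVariation F₁ F₂ τ b e x C) (hτ : τ ≤ b)
    (hΦ : HasFDerivAt Φ Φ' e) :
    (fun lam => Φ (x lam b) - Φ e - Φ' (x lam b - e)) =o[𝓝[>] 0] fun lam : ℝ => lam := by
  have hb : b ∈ Icc τ b := right_mem_Icc.2 hτ
  have hbigO : (fun lam => x lam b - e) =O[𝓝[>] 0] fun lam : ℝ => lam := by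
    refine Asymptotics.IsBigO.of_bound C ?_
    filter_upwards [hx.norm_sub_le, self_mem_nhdsWithin] with lam hnorm (hlam : 0 < lam)
    rw [Real.norm_of_nonneg hlam.le]
    exact hnorm b hb
  have htendsto : Tendsto (fun lam => x lam b) (𝓝[>] 0) (𝓝 e) := fun U hU =>
    (hx.eventually_mapsTo hU).mono fun lam hlam => hlam b hb
  exact (hΦ.isLittleO.comp_tendsto htendsto).trans_isBigO hbigO

end IsNeedleVariation

theorem hasDerivWithinAt_integral_Ici {V : Type*} [NormedAddCommGroup V] [NormedSpace ℝ V]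
    [CompleteSpace V] {c : ℝ → V} (hc : ContinuousOn c (Icc τ b)) {t : ℝ} (ht : t ∈ Ico τ b) :
    HasDerivWithinAt (fun s => ∫ u in τ..s, c u) (c t) (Ici t) t := by
  have hnhds : Icc τ b ∈ 𝓝[>] t := mem_of_superset (Icc_mem_nhdsGT ht.2) (Icc_subset_Icc_left ht.1)
  refine intervalIntegral.integral_hasDerivWithinAt_right (t := Ioi t) ?_
    ⟨Icc τ b, hnhds, hc.aestronglyMeasurable measurableSet_Icc⟩
    ((hc t ⟨ht.1, ht.2.le⟩).mono_of_mem_nhdsWithin hnhds)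
  refine ContinuousOn.intervalIntegrable ?_
  rw [uIcc_of_le ht.1]
  exact hc.mono (Icc_subset_Icc_right ht.2.le)

/-- The pairing of the displacement of `x` from `e` with the adjoint variable `ρ`, plus the excess
running cost accumulated since time `τ`. -/
noncomputable def adjointCost (ρ : ℝ → X →L[ℝ] ℝ) (ℓ : X → ℝ → ℝ) (τ : ℝ) (e : X) (x : ℝ → X)
    (t : ℝ) : ℝ :=
  ρ t (x t - e) + ∫ s in τ..t, (ℓ (x s) s - ℓ e s)

variable {ρ : ℝ → X →L[ℝ] ℝ} {ℓ : X → ℝ → ℝ} {x : ℝ → X}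

theorem continuousOn_adjointCost (hτ : τ ≤ b) (hρ : ContinuousOn ρ (Icc τ b))
    (hx : ContinuousOn x (Icc τ b)) (hℓ : ContinuousOn (fun t => ℓ (x t) t - ℓ e t) (Icc τ b)) :
    ContinuousOn (adjointCost ρ ℓ τ e x) (Icc τ b) := by
  have hint := intervalIntegral.continuousOn_primitive_interval (μ := volume)
    ((uIcc_of_le hτ).symm ▸ hℓ.integrableOn_Icc)
  rw [uIcc_of_le hτ] at hint
  exact (hρ.clm_apply (hx.sub continuousOn_const)).add hint

theorem hasDerivWithinAt_adjointCost {ρ' : X →L[ℝ] ℝ} {v : X} {t : ℝ} (ht : t ∈ Ico τ b)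
    (hρ : HasDerivWithinAt ρ ρ' (Icc τ b) t) (hx : HasDerivWithinAt x v (Ici t) t)
    (hℓ : ContinuousOn (fun t => ℓ (x t) t - ℓ e t) (Icc τ b)) :
    HasDerivWithinAt (adjointCost ρ ℓ τ e x)
      (ρ' (x t - e) + ρ t v + (ℓ (x t) t - ℓ e t)) (Ici t) t := by
  have hnhds : Icc τ b ∈ 𝓝[≥] t := mem_of_superset (Icc_mem_nhdsGE ht.2) (Icc_subset_Icc_left ht.1)
  exact ((hρ.mono_of_mem_nhdsWithin hnhds).clm_apply (hx.sub_const e)).add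
    (hasDerivWithinAt_integral_Ici hℓ ht)

/-- Since `ρ` is adjoint to the linearized Hamiltonian `H y t = ρ t (F₁ y t) + ℓ y t`, the
derivative of `adjointCost` is the second-order remainder of `H` away from the needle; only the
needle itself contributes to first order. -/
theorem IsNeedleCurve.norm_adjointCost_sub_le {D : ℝ → X →L[ℝ] ℝ} {q ε : ℝ}
    (hx : IsNeedleCurve F₁ F₂ τ b lam e x) (hlam : 0 ≤ lam) (hhalf : lam ≤ 1 / 2)
    (hb : τ + lam ≤ b) (hF₁ : ∀ t ∈ Icc τ b, F₁ e t = 0)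
    (hρ : ∀ t ∈ Icc τ b, HasDerivWithinAt ρ (-D t) (Icc τ b) t)
    (hℓ : ContinuousOn (fun t => ℓ (x t) t - ℓ e t) (Icc τ b))
    (hH : ∀ t ∈ Icc τ b, ‖ρ t (F₁ (x t) t) + ℓ (x t) t - (ρ t (F₁ e t) + ℓ e t) -
      D t (x t - e)‖ ≤ ε * lam)
    (hneedle : ∀ t ∈ Ico τ (τ + lam), ‖ρ t (F₂ (x t) t - F₁ (x t) t) - q‖ ≤ ε / 2) :
    ‖adjointCost ρ ℓ τ e x b - lam • q‖ ≤ ε * (1 + (b - τ)) * lam := by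
  have hρc : ContinuousOn ρ (Icc τ b) := fun t ht => (hρ t ht).continuousWithinAt
  refine norm_sub_smul_le_of_needle hlam hb (by simp [adjointCost, hx.init])
    (continuousOn_adjointCost (by linarith) hρc hx.cont hℓ) (fun t ht =>
      hasDerivWithinAt_adjointCost ht (hρ t ⟨ht.1, ht.2.le⟩) (hx.ode t ht) hℓ)
    (fun t ht => ?_) (fun t ht => ?_)
  · have htb : t ∈ Icc τ b := ⟨ht.1, by linarith [ht.2]⟩
    have hε : 0 ≤ ε := by linarith [(norm_nonneg _).trans (hneedle t ht)]
    rw [insertedMode_of_lt ht.1 ht.2]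
    calc ‖(-D t) (x t - e) + ρ t (F₂ (x t) t) + (ℓ (x t) t - ℓ e t) - q‖
        = ‖(ρ t (F₂ (x t) t - F₁ (x t) t) - q) +
            (ρ t (F₁ (x t) t) + ℓ (x t) t - (ρ t (F₁ e t) + ℓ e t) - D t (x t - e))‖ := by
          congr 1
          simp only [neg_apply, map_sub, hF₁ t htb, map_zero]
          ring
      _ ≤ ε / 2 + ε * lam := norm_add_le_of_le (hneedle t ht) (hH t htb)
      _ ≤ ε := by nlinarith
  · have htb : t ∈ Icc τ b := ⟨by linarith [ht.1], ht.2.le⟩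
    rw [insertedMode_of_ge ht.1]
    refine le_of_eq_of_le (congrArg norm ?_) (hH t htb)
    simp only [hF₁ t htb, neg_apply, map_zero]
    ring

theorem IsNeedleVariation.isLittleO_adjointCost {x : ℝ → ℝ → X} {C : ℝ} {D : ℝ → X →L[ℝ] ℝ}
    {U : Set X} (hx : IsNeedleVariation F₁ F₂ τ b e x C) (hτ : τ < b)
    (hF₁e : ∀ t ∈ Icc τ b, F₁ e t = 0)
    (hF₁ : ContinuousWithinAt F₁.uncurry (univ ×ˢ Icc τ b) (e, τ))
    (hF₂ : ContinuousWithinAt F₂.uncurry (univ ×ˢ Icc τ b) (e, τ))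
    (hU : U ∈ 𝓝 e) (hℓ : ContinuousOn ℓ.uncurry (U ×ˢ Icc τ b))
    (hH : HasUniformFDerivAt (fun y t => ρ t (F₁ y t) + ℓ y t) D e (Icc τ b))
    (hρ : ∀ t ∈ Icc τ b, HasDerivWithinAt ρ (-D t) (Icc τ b) t) :
    (fun lam => adjointCost ρ ℓ τ e (x lam) b - lam • ρ τ (F₂ e τ)) =o[𝓝[>] 0]
      fun lam : ℝ => lam := by
  have hτmem : τ ∈ Icc τ b := left_mem_Icc.2 hτ.le
  have hQ : ContinuousWithinAt (fun y t => ρ t (F₂ y t - F₁ y t)).uncurry (univ ×ˢ Icc τ b)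
      (e, τ) :=
    ((hρ τ hτmem).continuousWithinAt.comp continuousWithinAt_snd fun p hp => hp.2).clm_apply
      (hF₂.sub hF₁)
  have hbτ : 0 < 1 + (b - τ) := by linarith
  refine Asymptotics.isLittleO_iff.2 fun ε hε => ?_
  have hε' : 0 < ε / (1 + (b - τ)) := div_pos hε hbτ
  filter_upwards [hx.curve, hx.eventually_mapsTo hU, hx.eventually_norm_remainder_le hH hε',
    hx.eventually_norm_sub_le_of_needle hτ hQ (half_pos hε'), self_mem_nhdsWithin,
    nhdsWithin_le_nhds (Iio_mem_nhds (half_pos one_pos)),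
    nhdsWithin_le_nhds (Iio_mem_nhds (sub_pos.2 hτ))]
    with lam hcurve hmem hrem hneedle (hpos : 0 < lam) (hhalf : lam < 1 / 2) (hlamb : lam < b - τ)
  have hℓx : ContinuousOn (fun t => ℓ (x lam t) t - ℓ e t) (Icc τ b) :=
    (hℓ.comp (hcurve.cont.prodMk continuousOn_id) fun t ht => ⟨hmem t ht, ht⟩).sub
      (hℓ.comp (continuousOn_const.prodMk continuousOn_id) fun t ht => ⟨mem_of_mem_nhds hU, ht⟩)
  have hmain := hcurve.norm_adjointCost_sub_le hpos.le hhalf.le (by linarith) hF₁e hρ hℓx hrem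
    (q := ρ τ (F₂ e τ)) fun t ht => by simpa [hF₁e τ hτmem] using hneedle t ht
  rw [div_mul_cancel₀ ε hbτ.ne'] at hmain
  rwa [Real.norm_of_nonneg hpos.le]

end Needle

section ChartMul

variable (E : Type*) [NormedAddCommGroup E]
  (G : Type*) [TopologicalSpace G] [ChartedSpace E G] [Group G]

/-- The coordinates of the identity in the preferred chart at the identity. -/
noncomputable def chartOne : E := chartAt E (1 : G) 1

/-- The multiplication of the group in the preferred chart at the identity. -/
noncomputable def chartMul (p : E × E) : E :=
  chartAt E (1 : G) ((chartAt E (1 : G)).symm p.1 * (chartAt E (1 : G)).symm p.2)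

/-- The set where `chartMul` is the group multiplication: both factors and the product are
covered by the preferred chart at the identity. -/
def chartMulDomain : Set (E × E) :=
  {p | p ∈ (chartAt E (1 : G)).target ×ˢ (chartAt E (1 : G)).target ∧
    (chartAt E (1 : G)).symm p.1 * (chartAt E (1 : G)).symm p.2 ∈ (chartAt E (1 : G)).source}

variable {E G}

theorem chartOne_mem_target : chartOne E G ∈ (chartAt E (1 : G)).target := mem_chart_target E 1

@[simp]
theorem chart_symm_chartOne : (chartAt E (1 : G)).symm (chartOne E G) = 1 :=
  (chartAt E (1 : G)).left_inv (mem_chart_source E 1)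

theorem chartMul_chartOne_left {x : E} (hx : x ∈ (chartAt E (1 : G)).target) :
    chartMul E G (chartOne E G, x) = x := by
  simp [chartMul, (chartAt E (1 : G)).right_inv hx]

theorem chartMul_chartOne_right {x : E} (hx : x ∈ (chartAt E (1 : G)).target) :
    chartMul E G (x, chartOne E G) = x := by
  simp [chartMul, (chartAt E (1 : G)).right_inv hx]

theorem chartMul_chart {g h : G} (hg : g ∈ (chartAt E (1 : G)).source)
    (hh : h ∈ (chartAt E (1 : G)).source) :
    chartMul E G (chartAt E (1 : G) g, chartAt E (1 : G) h) = chartAt E (1 : G) (g * h) := by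
  rw [chartMul, (chartAt E (1 : G)).left_inv hg, (chartAt E (1 : G)).left_inv hh]

theorem mem_chartMulDomain_left {x : E} (hx : x ∈ (chartAt E (1 : G)).target) :
    (x, chartOne E G) ∈ chartMulDomain E G := by
  refine ⟨⟨hx, chartOne_mem_target⟩, ?_⟩
  simpa using (chartAt E (1 : G)).map_target hx

theorem mem_chartMulDomain_right {x : E} (hx : x ∈ (chartAt E (1 : G)).target) :
    (chartOne E G, x) ∈ chartMulDomain E G := by
  refine ⟨⟨chartOne_mem_target, hx⟩, ?_⟩
  simpa using (chartAt E (1 : G)).map_target hx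

variable (E G) [NormedSpace ℝ E]

/-- The left-invariant frame in the preferred chart at the identity: `leftFrame E G x v` is the
value at `x` of the left-invariant vector field generated by `v`. -/
noncomputable def leftFrame (x : E) : E →L[ℝ] E :=
  (fderiv ℝ (chartMul E G) (x, chartOne E G)).comp (ContinuousLinearMap.inr ℝ E E)

/-- The right-invariant frame in the preferred chart at the identity: `rightFrame E G x v` is the
value at `x` of the right-invariant vector field generated by `v`. -/
noncomputable def rightFrame (x : E) : E →L[ℝ] E :=
  (fderiv ℝ (chartMul E G) (chartOne E G, x)).comp (ContinuousLinearMap.inl ℝ E E)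

variable {E G} [LieGroup 𝓘(ℝ, E) ∞ G]

theorem isOpen_chartMulDomain : IsOpen (chartMulDomain E G) := by
  have : IsTopologicalGroup G := topologicalGroup_of_lieGroup 𝓘(ℝ, E) ∞
  have hmul : ContinuousOn (fun p : E × E => (chartAt E (1 : G)).symm p.1 *
      (chartAt E (1 : G)).symm p.2) ((chartAt E (1 : G)).target ×ˢ (chartAt E (1 : G)).target) :=
    ((chartAt E (1 : G)).continuousOn_symm.comp continuousOn_fst fun p hp => hp.1).mul
      ((chartAt E (1 : G)).continuousOn_symm.comp continuousOn_snd fun p hp => hp.2)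
  exact hmul.isOpen_inter_preimage
    ((chartAt E (1 : G)).open_target.prod (chartAt E (1 : G)).open_target)
    (chartAt E (1 : G)).open_source

theorem contDiffOn_chartMul : ContDiffOn ℝ ∞ (chartMul E G) (chartMulDomain E G) := by
  rw [← contMDiffOn_iff_contDiffOn]
  have hsymm : ContMDiffOn 𝓘(ℝ, E) 𝓘(ℝ, E) ∞ (chartAt E (1 : G)).symm (chartAt E (1 : G)).target :=
    contMDiffOn_chart_symm
  have hchart : ContMDiffOn 𝓘(ℝ, E) 𝓘(ℝ, E) ∞ (chartAt E (1 : G)) (chartAt E (1 : G)).source :=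
    contMDiffOn_chart
  have hfst : ContMDiffOn 𝓘(ℝ, E × E) 𝓘(ℝ, E) ∞ (Prod.fst : E × E → E) (chartMulDomain E G) :=
    contDiff_fst.contMDiff.contMDiffOn
  have hsnd : ContMDiffOn 𝓘(ℝ, E × E) 𝓘(ℝ, E) ∞ (Prod.snd : E × E → E) (chartMulDomain E G) :=
    contDiff_snd.contMDiff.contMDiffOn
  exact hchart.comp ((hsymm.comp hfst fun p hp => hp.1.1).mul (hsymm.comp hsnd fun p hp => hp.1.2))
    fun p hp => hp.2

theorem differentiableAt_chartMul {p : E × E} (hp : p ∈ chartMulDomain E G) :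
    DifferentiableAt ℝ (chartMul E G) p :=
  (contDiffOn_chartMul.contDiffAt (isOpen_chartMulDomain.mem_nhds hp)).differentiableAt (by simp)

theorem contDiffOn_fderiv_chartMul :
    ContDiffOn ℝ ∞ (fderiv ℝ (chartMul E G)) (chartMulDomain E G) :=
  contDiffOn_chartMul.fderiv_of_isOpen isOpen_chartMulDomain (by simp)

theorem contDiffOn_leftFrame : ContDiffOn ℝ ∞ (leftFrame E G) (chartAt E (1 : G)).target := by
  have hderiv : ContDiffOn ℝ ∞ (fun x => fderiv ℝ (chartMul E G) (x, chartOne E G))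
      (chartAt E (1 : G)).target :=
    contDiffOn_fderiv_chartMul.comp (contDiff_id.prodMk contDiff_const).contDiffOn
      fun x hx => mem_chartMulDomain_left hx
  exact hderiv.clm_comp contDiffOn_const

theorem contDiffOn_rightFrame : ContDiffOn ℝ ∞ (rightFrame E G) (chartAt E (1 : G)).target := by
  have hderiv : ContDiffOn ℝ ∞ (fun x => fderiv ℝ (chartMul E G) (chartOne E G, x))
      (chartAt E (1 : G)).target :=
    contDiffOn_fderiv_chartMul.comp (contDiff_const.prodMk contDiff_id).contDiffOn
      fun x hx => mem_chartMulDomain_right hx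
  exact hderiv.clm_comp contDiffOn_const

theorem hasFDerivAt_chartMul_chartOne_left {x : E} (hx : x ∈ (chartAt E (1 : G)).target) :
    HasFDerivAt (chartMul E G) ((rightFrame E G x).coprod (ContinuousLinearMap.id ℝ E))
      (chartOne E G, x) := by
  have hmul := (differentiableAt_chartMul (mem_chartMulDomain_right hx)).hasFDerivAt
  have hid : HasFDerivAt (fun y : E => chartMul E G (chartOne E G, y))
      (ContinuousLinearMap.id ℝ E) x :=
    (hasFDerivAt_id x).congr_of_eventuallyEq (mem_of_superset
      ((chartAt E (1 : G)).open_target.mem_nhds hx) fun y hy => chartMul_chartOne_left hy)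
  rwa [hid.unique (hmul.comp x (hasFDerivAt_prodMk_right _ x)), rightFrame,
    ContinuousLinearMap.coprod_comp_inl_inr]

theorem hasFDerivAt_chartMul_chartOne_right {x : E} (hx : x ∈ (chartAt E (1 : G)).target) :
    HasFDerivAt (chartMul E G) ((ContinuousLinearMap.id ℝ E).coprod (leftFrame E G x))
      (x, chartOne E G) := by
  have hmul := (differentiableAt_chartMul (mem_chartMulDomain_left hx)).hasFDerivAt
  have hid : HasFDerivAt (fun y : E => chartMul E G (y, chartOne E G))
      (ContinuousLinearMap.id ℝ E) x :=
    (hasFDerivAt_id x).congr_of_eventuallyEq (mem_of_superset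
      ((chartAt E (1 : G)).open_target.mem_nhds hx) fun y hy => chartMul_chartOne_right hy)
  rwa [hid.unique (HasFDerivAt.comp (g := chartMul E G) x hmul (hasFDerivAt_prodMk_left x _)),
    leftFrame, ContinuousLinearMap.coprod_comp_inl_inr]

theorem leftFrame_chartOne : leftFrame E G (chartOne E G) = ContinuousLinearMap.id ℝ E := by
  rw [leftFrame, (hasFDerivAt_chartMul_chartOne_left chartOne_mem_target).fderiv,
    ContinuousLinearMap.coprod_comp_inr]

theorem rightFrame_chartOne : rightFrame E G (chartOne E G) = ContinuousLinearMap.id ℝ E := by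
  rw [rightFrame, (hasFDerivAt_chartMul_chartOne_right chartOne_mem_target).fderiv,
    ContinuousLinearMap.coprod_comp_inl]

theorem differentiableAt_leftFrame {x : E} (hx : x ∈ (chartAt E (1 : G)).target) :
    DifferentiableAt ℝ (leftFrame E G) x :=
  (contDiffOn_leftFrame.contDiffAt
    ((chartAt E (1 : G)).open_target.mem_nhds hx)).differentiableAt (by simp)

theorem differentiableAt_rightFrame {x : E} (hx : x ∈ (chartAt E (1 : G)).target) :
    DifferentiableAt ℝ (rightFrame E G) x :=
  (contDiffOn_rightFrame.contDiffAt
    ((chartAt E (1 : G)).open_target.mem_nhds hx)).differentiableAt (by simp)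

theorem fderiv_rightFrame_chartOne (v w : E) :
    fderiv ℝ (rightFrame E G) (chartOne E G) v w =
      fderiv ℝ (leftFrame E G) (chartOne E G) w v := by
  have hmem := isOpen_chartMulDomain.mem_nhds
    (mem_chartMulDomain_left (chartOne_mem_target (E := E) (G := G)))
  have hsymm := ((contDiffOn_chartMul.contDiffAt hmem).isSymmSndFDerivAt (by
    rw [minSmoothness_of_isRCLikeNormedField]; exact WithTop.coe_le_coe.2 le_top)).eq (0, v) (w, 0)
  have hD : HasFDerivAt (fderiv ℝ (chartMul E G))
      (fderiv ℝ (fderiv ℝ (chartMul E G)) (chartOne E G, chartOne E G))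
      (chartOne E G, chartOne E G) :=
    ((contDiffOn_fderiv_chartMul.contDiffAt hmem).differentiableAt (by simp)).hasFDerivAt
  have hleft : HasFDerivAt (leftFrame E G) _ (chartOne E G) :=
    (HasFDerivAt.comp (g := fderiv ℝ (chartMul E G)) (f := fun y : E => (y, chartOne E G))
      (chartOne E G) hD (hasFDerivAt_prodMk_left _ _)).clm_comp
      (hasFDerivAt_const (ContinuousLinearMap.inr ℝ E E) _)
  have hright : HasFDerivAt (rightFrame E G) _ (chartOne E G) :=
    (HasFDerivAt.comp (g := fderiv ℝ (chartMul E G)) (f := fun y : E => (chartOne E G, y))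
      (chartOne E G) hD (hasFDerivAt_prodMk_right _ _)).clm_comp
      (hasFDerivAt_const (ContinuousLinearMap.inl ℝ E E) _)
  rw [hleft.fderiv, hright.fderiv]
  simpa using hsymm

end ChartMul

section LogDeriv

variable {E : Type*} [NormedAddCommGroup E] [NormedSpace ℝ E]
  {G : Type*} [TopologicalSpace G] [ChartedSpace E G] [Group G]

theorem mulInvariantVectorField_one (η : GroupLieAlgebra 𝓘(ℝ, E) G) :
    mulInvariantVectorField (I := 𝓘(ℝ, E)) η (1 : G) = η := by
  have hderiv : mfderiv 𝓘(ℝ, E) 𝓘(ℝ, E) (fun y : G => 1 * y) 1 = ContinuousLinearMap.id ℝ E := by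
    have hid : (fun y : G => 1 * y) = id := funext one_mul
    rw [hid]
    exact mfderiv_id
  exact congrArg (fun A : E →L[ℝ] E => A η) hderiv

variable [LieGroup 𝓘(ℝ, E) ∞ G]

theorem hasMFDerivAt_mul_left (q g : G) :
    HasMFDerivAt 𝓘(ℝ, E) 𝓘(ℝ, E) (fun y : G => q * y) g
      (mfderiv 𝓘(ℝ, E) 𝓘(ℝ, E) (fun y : G => q * y) g) :=
  ((contMDiff_mul_left (I := 𝓘(ℝ, E)) (n := ∞) (a := q)).mdifferentiable
    (by simp)).mdifferentiableAt.hasMFDerivAt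

theorem hasMFDerivAt_chart_one :
    HasMFDerivAt 𝓘(ℝ, E) 𝓘(ℝ, E) (chartAt E (1 : G)) 1 (ContinuousLinearMap.id ℝ E) := by
  have : IsManifold 𝓘(ℝ, E) 1 G := IsManifold.of_le (n := ∞) (mod_cast le_top)
  have hchart :=
    (mdifferentiableAt_extChartAt (I := 𝓘(ℝ, E)) (mem_chart_source E (1 : G))).hasMFDerivAt
  rw [mfderiv_extChartAt_self] at hchart
  simpa using! hchart

theorem hasMFDerivAt_chart_symm_chartOne :
    HasMFDerivAt 𝓘(ℝ, E) 𝓘(ℝ, E) (chartAt E (1 : G)).symm (chartOne E G)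
      (ContinuousLinearMap.id ℝ E) := by
  have : IsManifold 𝓘(ℝ, E) 1 G := IsManifold.of_le (n := ∞) (mod_cast le_top)
  have hsymm := (mdifferentiableWithinAt_extChartAt_symm (I := 𝓘(ℝ, E))
    (mem_extChartAt_target (I := 𝓘(ℝ, E)) (1 : G))).hasMFDerivWithinAt
  rw [mfderivWithin_range_extChartAt_symm] at hsymm
  have hwithin : HasMFDerivWithinAt 𝓘(ℝ, E) 𝓘(ℝ, E) (chartAt E (1 : G)).symm univ (chartOne E G)
      (ContinuousLinearMap.id ℝ E) := by
    simpa [chartOne] using! hsymm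
  exact hasMFDerivWithinAt_univ.1 hwithin

theorem mfderiv_mul_left_mulInvariantVectorField (x q : G) (η : GroupLieAlgebra 𝓘(ℝ, E) G) :
    mfderiv 𝓘(ℝ, E) 𝓘(ℝ, E) (fun y : G => x * y) q
      (mulInvariantVectorField (I := 𝓘(ℝ, E)) η q) =
      mulInvariantVectorField (I := 𝓘(ℝ, E)) η (x * q) := by
  have hleft : HasMFDerivAt 𝓘(ℝ, E) 𝓘(ℝ, E) (fun y : G => x * y) (q * 1)
      (mfderiv 𝓘(ℝ, E) 𝓘(ℝ, E) (fun y : G => x * y) q : E →L[ℝ] E) := by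
    rw [mul_one]; exact hasMFDerivAt_mul_left x q
  have hmul : (fun y : G => x * q * y) = (fun y : G => x * y) ∘ (fun y : G => q * y) := by
    funext y; simp [mul_assoc]
  have hchain := (hleft.comp 1 (hasMFDerivAt_mul_left q 1)).mfderiv
  rw [← hmul] at hchain
  exact (congrArg (fun A : E →L[ℝ] E => A η) hchain).symm

theorem mfderiv_chart_mulInvariantVectorField {g : G} (hg : g ∈ (chartAt E (1 : G)).source)
    (v : E) :
    (mfderiv 𝓘(ℝ, E) 𝓘(ℝ, E) (chartAt E (1 : G)) g : E →L[ℝ] E)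
      (mulInvariantVectorField (I := 𝓘(ℝ, E)) (v : GroupLieAlgebra 𝓘(ℝ, E) G) g) =
      leftFrame E G (chartAt E (1 : G) g) v := by
  have : IsManifold 𝓘(ℝ, E) 1 G := IsManifold.of_le (n := ∞) (mod_cast le_top)
  let A : E →L[ℝ] E := mfderiv 𝓘(ℝ, E) 𝓘(ℝ, E) (chartAt E (1 : G)) g
  let B : E →L[ℝ] E := mfderiv 𝓘(ℝ, E) 𝓘(ℝ, E) (fun y : G => g * y) 1
  have hchart : HasMFDerivAt 𝓘(ℝ, E) 𝓘(ℝ, E) (chartAt E (1 : G)) (g * 1) A := by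
    rw [mul_one]
    exact (mdifferentiableAt_atlas (chart_mem_atlas E (1 : G)) hg).hasMFDerivAt
  have htranslate : HasMFDerivAt 𝓘(ℝ, E) 𝓘(ℝ, E) (fun y : G => chartAt E (1 : G) (g * y))
      ((chartAt E (1 : G)).symm (chartOne E G)) (A.comp B) := by
    rw [chart_symm_chartOne]
    exact hchart.comp (1 : G) (hasMFDerivAt_mul_left g 1)
  have hcomp : HasMFDerivAt 𝓘(ℝ, E) 𝓘(ℝ, E)
      (fun y : E => chartAt E (1 : G) (g * (chartAt E (1 : G)).symm y)) (chartOne E G)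
      ((A.comp B).comp (ContinuousLinearMap.id ℝ E)) :=
    HasMFDerivAt.comp (g := fun y : G => chartAt E (1 : G) (g * y)) (chartOne E G) htranslate
      hasMFDerivAt_chart_symm_chartOne
  have hframe : HasFDerivAt (fun y : E => chartAt E (1 : G) (g * (chartAt E (1 : G)).symm y))
      (leftFrame E G (chartAt E (1 : G) g)) (chartOne E G) := by
    have hmul := (differentiableAt_chartMul (mem_chartMulDomain_left (G := G)
      ((chartAt E (1 : G)).map_source hg))).hasFDerivAt.comp (chartOne E G)
        (hasFDerivAt_prodMk_right _ _)
    simpa only [Function.comp_def, chartMul, (chartAt E (1 : G)).left_inv hg] using! hmul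
  have hcomp' : HasFDerivAt (fun y : E => chartAt E (1 : G) (g * (chartAt E (1 : G)).symm y))
      (A.comp B) (chartOne E G) := hcomp.hasFDerivAt
  exact congrArg (fun T : E →L[ℝ] E => T v) (hcomp'.unique hframe)

theorem lieBracketWithin_leftFrame {V W : E → E} (v w : E)
    (hV : V =ᶠ[𝓝 (chartOne E G)] fun x => leftFrame E G x v)
    (hW : W =ᶠ[𝓝 (chartOne E G)] fun x => leftFrame E G x w) :
    VectorField.lieBracketWithin ℝ V W univ (chartOne E G) =
      fderiv ℝ (leftFrame E G) (chartOne E G) v w -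
        fderiv ℝ (leftFrame E G) (chartOne E G) w v := by
  have hframe : ∀ u : E, HasFDerivAt (fun x => leftFrame E G x u)
      ((fderiv ℝ (leftFrame E G) (chartOne E G)).flip u) (chartOne E G) := fun u => by
    simpa using (differentiableAt_leftFrame
      (chartOne_mem_target (E := E) (G := G))).hasFDerivAt.clm_apply
        (hasFDerivAt_const u (chartOne E G))
  rw [VectorField.lieBracketWithin_univ, hV.lieBracket_vectorField_eq hW, VectorField.lieBracket,
    (hframe v).fderiv, (hframe w).fderiv]
  simp only [ContinuousLinearMap.flip_apply, leftFrame_chartOne, ContinuousLinearMap.id_apply]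

theorem mpullbackWithin_mulInvariantVectorField_eventuallyEq (v : E) :
    (VectorField.mpullbackWithin 𝓘(ℝ, E) 𝓘(ℝ, E) (extChartAt 𝓘(ℝ, E) (1 : G)).symm
      (mulInvariantVectorField (I := 𝓘(ℝ, E)) (v : GroupLieAlgebra 𝓘(ℝ, E) G))
      (range 𝓘(ℝ, E)) : E → E) =ᶠ[𝓝 (chartOne E G)] fun x => leftFrame E G x v := by
  have : IsManifold 𝓘(ℝ, E) 1 G := IsManifold.of_le (n := ∞) (mod_cast le_top)
  filter_upwards [(chartAt E (1 : G)).open_target.mem_nhds chartOne_mem_target] with x hx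
  have hx' : x ∈ (extChartAt 𝓘(ℝ, E) (1 : G)).target := by simpa using hx
  have hframe := mfderiv_chart_mulInvariantVectorField ((chartAt E (1 : G)).map_target hx) v
  rw [(chartAt E (1 : G)).right_inv hx] at hframe
  have hinv := ContinuousLinearMap.inverse_eq
    (mfderivWithin_extChartAt_symm_comp_mfderiv_extChartAt hx')
    (mfderiv_extChartAt_comp_mfderivWithin_extChartAt_symm hx')
  rw [← hframe, VectorField.mpullbackWithin_apply, hinv]
  simp only [mfld_simps]
  rfl

theorem bracket_eq_fderiv_leftFrame (v w : GroupLieAlgebra 𝓘(ℝ, E) G) :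
    ⁅v, w⁆ = (fderiv ℝ (leftFrame E G) (chartOne E G) (v : E) (w : E) -
        fderiv ℝ (leftFrame E G) (chartOne E G) (w : E) (v : E) : E) := by
  have : IsManifold 𝓘(ℝ, E) 1 G := IsManifold.of_le (n := ∞) (mod_cast le_top)
  have hset : (extChartAt 𝓘(ℝ, E) (1 : G)).symm ⁻¹' univ ∩ range 𝓘(ℝ, E) = univ := by simp
  have hpt : extChartAt 𝓘(ℝ, E) (1 : G) 1 = chartOne E G := by simp [chartOne]
  rw [GroupLieAlgebra.bracket_def, VectorField.mlieBracket, VectorField.mlieBracketWithin_apply,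
    mfderiv_extChartAt_self, hset, hpt]
  exact (congrArg (fun A : E →L[ℝ] E => A _) ContinuousLinearMap.inverse_id).trans
    (lieBracketWithin_leftFrame (E := E) (G := G) v w
      (mpullbackWithin_mulInvariantVectorField_eventuallyEq (E := E) v)
      (mpullbackWithin_mulInvariantVectorField_eventuallyEq (E := E) w))

/-- The curve `c` has left logarithmic derivative `c⁻¹ ċ = ξ` at `t` within `s`; the Lie algebra is
identified with the model space `E`. -/
def HasLeftLogDerivWithinAt (c : ℝ → G) (ξ : E) (s : Set ℝ) (t : ℝ) : Prop :=
  HasMFDerivWithinAt 𝓘(ℝ, ℝ) 𝓘(ℝ, E) c s t ((1 : ℝ →L[ℝ] ℝ).smulRight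
    (mulInvariantVectorField (I := 𝓘(ℝ, E)) (ξ : GroupLieAlgebra 𝓘(ℝ, E) G) (c t)))

namespace HasLeftLogDerivWithinAt

variable {c c₁ c₂ : ℝ → G} {ξ ξ₁ ξ₂ : E} {s : Set ℝ} {t : ℝ}

theorem hasDerivWithinAt_chart (hc : HasLeftLogDerivWithinAt c ξ s t) :
    HasDerivWithinAt (fun u => chartAt E (1 : G) ((c t)⁻¹ * c u)) ξ s t := by
  let A : E →L[ℝ] E := mfderiv 𝓘(ℝ, E) 𝓘(ℝ, E) (fun y : G => (c t)⁻¹ * y) (c t)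
  let η : E := mulInvariantVectorField (I := 𝓘(ℝ, E)) (ξ : GroupLieAlgebra 𝓘(ℝ, E) G) (c t)
  have hvelocity : A η = ξ := by
    refine (mfderiv_mul_left_mulInvariantVectorField (c t)⁻¹ (c t)
      (ξ : GroupLieAlgebra 𝓘(ℝ, E) G)).trans ?_
    rw [inv_mul_cancel]
    exact mulInvariantVectorField_one (G := G) ξ
  have hchart : HasMFDerivAt 𝓘(ℝ, E) 𝓘(ℝ, E) (chartAt E (1 : G)) ((c t)⁻¹ * c t)
      (ContinuousLinearMap.id ℝ E) := by
    rw [inv_mul_cancel]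
    exact hasMFDerivAt_chart_one
  have htranslate : HasMFDerivWithinAt 𝓘(ℝ, ℝ) 𝓘(ℝ, E) (fun u => (c t)⁻¹ * c u) s t
      (A.comp ((1 : ℝ →L[ℝ] ℝ).smulRight η)) :=
    (hasMFDerivAt_mul_left (c t)⁻¹ (c t)).comp_hasMFDerivWithinAt t hc
  have hcomp : HasFDerivWithinAt (fun u => chartAt E (1 : G) ((c t)⁻¹ * c u))
      ((ContinuousLinearMap.id ℝ E).comp (A.comp ((1 : ℝ →L[ℝ] ℝ).smulRight η))) s t :=
    (hchart.comp_hasMFDerivWithinAt t htranslate).hasFDerivWithinAt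
  simpa [hvelocity] using hcomp.hasDerivWithinAt

theorem differentiableWithinAt_chart_inv_mul (hc₁ : HasLeftLogDerivWithinAt c₁ ξ₁ s t)
    (hc₂ : HasLeftLogDerivWithinAt c₂ ξ₂ s t)
    (hmem : (c₁ t)⁻¹ * c₂ t ∈ (chartAt E (1 : G)).source) :
    DifferentiableWithinAt ℝ (fun u => chartAt E (1 : G) ((c₁ u)⁻¹ * c₂ u)) s t := by
  have : IsManifold 𝓘(ℝ, E) 1 G := IsManifold.of_le (n := ∞) (mod_cast le_top)
  have hdiv : MDifferentiableAt (𝓘(ℝ, E).prod 𝓘(ℝ, E)) 𝓘(ℝ, E) (fun p : G × G => p.1⁻¹ * p.2)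
      (c₁ t, c₂ t) :=
    ((contMDiff_fst.inv.mul contMDiff_snd : ContMDiff (𝓘(ℝ, E).prod 𝓘(ℝ, E)) 𝓘(ℝ, E) ∞
      (fun p : G × G => p.1⁻¹ * p.2)).mdifferentiable (by simp)) _
  have hchart : MDifferentiableAt 𝓘(ℝ, E) 𝓘(ℝ, E) (chartAt E (1 : G)) ((c₁ t)⁻¹ * c₂ t) :=
    mdifferentiableAt_atlas (chart_mem_atlas E (1 : G)) hmem
  exact (hchart.comp_mdifferentiableWithinAt t (hdiv.comp_mdifferentiableWithinAt t
    (hc₁.mdifferentiableWithinAt.prodMk hc₂.mdifferentiableWithinAt))).differentiableWithinAt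

theorem eventually_inv_mul_mem_source (hc : HasLeftLogDerivWithinAt c ξ s t) :
    ∀ᶠ u in 𝓝[s] t, (c t)⁻¹ * c u ∈ (chartAt E (1 : G)).source := by
  have : IsTopologicalGroup G := topologicalGroup_of_lieGroup 𝓘(ℝ, E) ∞
  refine (hc.continuousWithinAt.const_mul (c t)⁻¹ :
    ContinuousWithinAt (fun u => (c t)⁻¹ * c u) s t) ((chartAt E (1 : G)).open_source.mem_nhds ?_)
  simp

theorem eventually_chartMul_eq (hc₁ : HasLeftLogDerivWithinAt c₁ ξ₁ s t)
    (hc₂ : HasLeftLogDerivWithinAt c₂ ξ₂ s t)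
    (hmem : (c₁ t)⁻¹ * c₂ t ∈ (chartAt E (1 : G)).source) :
    (fun u => chartMul E G (chartAt E (1 : G) ((c₁ t)⁻¹ * c₁ u),
      chartAt E (1 : G) ((c₁ u)⁻¹ * c₂ u))) =ᶠ[𝓝[s] t]
    fun u => chartMul E G (chartAt E (1 : G) ((c₁ t)⁻¹ * c₂ t),
      chartAt E (1 : G) ((c₂ t)⁻¹ * c₂ u)) := by
  have : IsTopologicalGroup G := topologicalGroup_of_lieGroup 𝓘(ℝ, E) ∞
  have hquot : ContinuousWithinAt (fun u => (c₁ u)⁻¹ * c₂ u) s t :=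
    hc₁.continuousWithinAt.inv.mul hc₂.continuousWithinAt
  filter_upwards [hc₁.eventually_inv_mul_mem_source, hc₂.eventually_inv_mul_mem_source,
    hquot ((chartAt E (1 : G)).open_source.mem_nhds hmem)] with u h₁ h₂ h₁₂
  rw [chartMul_chart h₁ h₁₂, chartMul_chart hmem h₂]
  group

/-- Differentiate the identity `(c₁(t)⁻¹ c₁(u)) (c₁(u)⁻¹ c₂(u)) = (c₁(t)⁻¹ c₂(t)) (c₂(t)⁻¹ c₂(u))`
at `u = t`: in the chart, the left-hand side has derivative `r(x) ξ₁ + ẋ` and the right-hand side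
`ℓ(x) ξ₂`, for the frames `r` and `ℓ`. -/
theorem hasDerivWithinAt_chart_inv_mul (hc₁ : HasLeftLogDerivWithinAt c₁ ξ₁ s t)
    (hc₂ : HasLeftLogDerivWithinAt c₂ ξ₂ s t) (hs : UniqueDiffWithinAt ℝ s t) (hts : t ∈ s)
    (hmem : (c₁ t)⁻¹ * c₂ t ∈ (chartAt E (1 : G)).source) :
    HasDerivWithinAt (fun u => chartAt E (1 : G) ((c₁ u)⁻¹ * c₂ u))
      (leftFrame E G (chartAt E (1 : G) ((c₁ t)⁻¹ * c₂ t)) ξ₂ -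
        rightFrame E G (chartAt E (1 : G) ((c₁ t)⁻¹ * c₂ t)) ξ₁) s t := by
  obtain ⟨v, hv⟩ : ∃ v, HasDerivWithinAt (fun u => chartAt E (1 : G) ((c₁ u)⁻¹ * c₂ u)) v s t :=
    ⟨_, (hc₁.differentiableWithinAt_chart_inv_mul hc₂ hmem).hasDerivWithinAt⟩
  have hx := (chartAt E (1 : G)).map_source hmem
  have hone : ∀ g : G, chartAt E (1 : G) (g⁻¹ * g) = chartOne E G := fun g => by
    rw [inv_mul_cancel, chartOne]
  have hleft := HasFDerivAt.comp_hasDerivWithinAt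
    (f := fun u => (chartAt E (1 : G) ((c₁ t)⁻¹ * c₁ u), chartAt E (1 : G) ((c₁ u)⁻¹ * c₂ u)))
    t (by simpa only [hone] using hasFDerivAt_chartMul_chartOne_left hx)
    (hc₁.hasDerivWithinAt_chart.prodMk hv)
  have hright := HasFDerivAt.comp_hasDerivWithinAt
    (f := fun u => (chartAt E (1 : G) ((c₁ t)⁻¹ * c₂ t), chartAt E (1 : G) ((c₂ t)⁻¹ * c₂ u)))
    t (by simpa only [hone] using hasFDerivAt_chartMul_chartOne_right hx)
    ((hasDerivWithinAt_const t s _).prodMk hc₂.hasDerivWithinAt_chart)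
  have heq := hs.eq_deriv _ hleft
    (hright.congr_of_eventuallyEq_of_mem (hc₁.eventually_chartMul_eq hc₂ hmem) hts)
  simp only [ContinuousLinearMap.coprod_apply, ContinuousLinearMap.id_apply, zero_add] at heq
  rwa [← heq, add_sub_cancel_left]

end HasLeftLogDerivWithinAt

variable [FiniteDimensional ℝ E] [T2Space G]

theorem exists_oneParameterSubgroup (η : GroupLieAlgebra 𝓘(ℝ, E) G) :
    ∃ c : ℝ → G, Continuous c ∧ c 0 = 1 ∧ (∀ s : ℝ, lieExp (s • η) = c s) ∧
      HasDerivAt (F := E) (fun s => chartAt E (1 : G) (c s)) η 0 := by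
  obtain ⟨c, h0, hc⟩ := exists_integralCurve η
  refine ⟨c, hc.continuous, h0, fun s => ?_, ?_⟩
  · have hscale := hc.comp_mul s
    rw [← mulInvariantVectorField_smul] at hscale
    rw [lieExp_eq _ (c ∘ (· * s)) (by simp [h0]) hscale]
    simp
  · have hlog : HasLeftLogDerivWithinAt (E := E) c η univ 0 := (hc 0).hasMFDerivWithinAt
    have hchart : HasDerivWithinAt (F := E) (fun s => chartAt E (1 : G) (c s)) η univ 0 := by
      simpa [h0] using! hlog.hasDerivWithinAt_chart
    exact hasDerivWithinAt_univ.1 hchart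

theorem leftDeriv_eq_of_hasFDerivAt {V : Type*} [NormedAddCommGroup V] [NormedSpace ℝ V]
    {f : G → V} {g : G} {f' : E →L[ℝ] V}
    (hf : HasFDerivAt (fun x : E => f (g * (chartAt E (1 : G)).symm x)) f' (chartOne E G))
    (η : GroupLieAlgebra 𝓘(ℝ, E) G) : leftDeriv f g η = f' (η : E) := by
  obtain ⟨c, hcont, h0, hexp, hchart⟩ := exists_oneParameterSubgroup η
  rw [leftDeriv]
  simp only [hexp]
  have hf' : HasFDerivAt (fun x : E => f (g * (chartAt E (1 : G)).symm x)) f'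
      (chartAt E (1 : G) (c 0)) := by rw [h0]; exact hf
  have hcomp := HasFDerivAt.comp_hasDerivAt (l := fun x : E => f (g * (chartAt E (1 : G)).symm x))
    (f := fun s => chartAt E (1 : G) (c s)) 0 hf' hchart
  refine HasDerivAt.deriv (hcomp.congr_of_eventuallyEq ?_)
  have hsource : ∀ᶠ s in 𝓝 (0 : ℝ), c s ∈ (chartAt E (1 : G)).source :=
    hcont.continuousAt ((chartAt E (1 : G)).open_source.mem_nhds (by
      rw [h0]; exact mem_chart_source E 1))
  filter_upwards [hsource] with s hs
  simp [(chartAt E (1 : G)).left_inv hs]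

end LogDeriv

section ParametricDerivative

variable {B : Type*} [NormedAddCommGroup B] [NormedSpace ℝ B]
  {H : Type*} [TopologicalSpace H] {I : ModelWithCorners ℝ B H}
  {N : Type*} [TopologicalSpace N] [ChartedSpace H N]
  {E : Type*} [NormedAddCommGroup E] [NormedSpace ℝ E]
  {V : Type*} [NormedAddCommGroup V] [NormedSpace ℝ V]
  {F : N → E → V} {S : Set N} {U : Set E}

theorem contDiffOn_right_of_contMDiffOn_uncurry
    (hF : ContMDiffOn (I.prod 𝓘(ℝ, E)) 𝓘(ℝ, V) 1 F.uncurry (S ×ˢ U)) {q : N} (hq : q ∈ S) :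
    ContDiffOn ℝ 1 (F q) U :=
  contMDiffOn_iff_contDiffOn.1 <| hF.comp
    (contMDiff_const.prodMk contMDiff_id : ContMDiff 𝓘(ℝ, E) _ 1 fun y : E => (q, y)).contMDiffOn
    fun _ hy => ⟨hq, hy⟩

theorem continuousOn_fderiv_of_contMDiffOn_uncurry [IsManifold I 1 N] (hU : IsOpen U)
    (hF : ContMDiffOn (I.prod 𝓘(ℝ, E)) 𝓘(ℝ, V) 1 F.uncurry (S ×ˢ U)) :
    ContinuousOn (fun q : N × E => fderiv ℝ (F q.1) q.2) (S ×ˢ U) := by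
  intro q hq
  have hparam : ContMDiffWithinAt ((I.prod 𝓘(ℝ, E)).prod 𝓘(ℝ, E)) 𝓘(ℝ, V) 1
      (Function.uncurry fun (n : N × E) (y : E) => F n.1 y) ((S ×ˢ U) ×ˢ U) (q, q.2) :=
    (hF.comp ((contMDiff_fst.comp contMDiff_fst).prodMk contMDiff_snd :
        ContMDiff ((I.prod 𝓘(ℝ, E)).prod 𝓘(ℝ, E)) _ 1
          fun r : (N × E) × E => (r.1.1, r.2)).contMDiffOn
      fun r hr => ⟨hr.1.1, hr.2⟩) (q, q.2) ⟨hq, hq.2⟩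
  have hderiv := (ContMDiffWithinAt.mfderivWithin (m := 0) (g := Prod.snd) hparam
    contMDiffWithinAt_snd hq (fun r hr => hr.2) (by simp) hU.uniqueMDiffOn).continuousWithinAt
  simp only [mfderivWithin_eq_fderivWithin] at hderiv
  have hcoord := inTangentCoordinates_model_space (I := 𝓘(ℝ, E)) (I' := 𝓘(ℝ, V))
    (Prod.snd : N × E → E) (fun r => F r.1 r.2) (fun r => fderivWithin ℝ (F r.1) U r.2) q
  have hwithin : ContinuousWithinAt (fun r : N × E => fderivWithin ℝ (F r.1) U r.2) (S ×ˢ U) q :=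
    Eq.mp (congrArg (fun D => ContinuousWithinAt D (S ×ˢ U) q) hcoord) hderiv
  exact hwithin.congr (fun r hr => (fderivWithin_of_isOpen hU hr.2).symm)
    (fderivWithin_of_isOpen hU hq.2).symm

variable {T : Type*} [TopologicalSpace T] {K : Set T} {σ : T → N} {e : E}

theorem continuousOn_fderiv_comp_of_contMDiffOn_uncurry [IsManifold I 1 N] (hU : IsOpen U)
    (he : e ∈ U) (hF : ContMDiffOn (I.prod 𝓘(ℝ, E)) 𝓘(ℝ, V) 1 F.uncurry (S ×ˢ U))
    (hσ : ContinuousOn σ K) (hσS : MapsTo σ K S) :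
    ContinuousOn (fun t => fderiv ℝ (F (σ t)) e) K :=
  (continuousOn_fderiv_of_contMDiffOn_uncurry hU hF).comp (f := fun t => (σ t, e))
    (hσ.prodMk continuousOn_const) fun _ ht => ⟨hσS ht, he⟩

theorem hasUniformFDerivAt_of_contMDiffOn_uncurry [IsManifold I 1 N] (hU : IsOpen U)
    (he : e ∈ U) (hF : ContMDiffOn (I.prod 𝓘(ℝ, E)) 𝓘(ℝ, V) 1 F.uncurry (S ×ˢ U))
    (hK : IsCompact K) (hσ : ContinuousOn σ K) (hσS : MapsTo σ K S) :
    HasUniformFDerivAt (fun x t => F (σ t) x) (fun t => fderiv ℝ (F (σ t)) e) e K := by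
  refine hasUniformFDerivAt_of_continuousOn (D := fun y t => fderiv ℝ (F (σ t)) y)
    (hU.mem_nhds he) hK (fun y hy t ht => ?_) ?_
  · exact ((contDiffOn_right_of_contMDiffOn_uncurry hF (hσS ht)).contDiffAt
      (hU.mem_nhds hy)).differentiableAt (by simp) |>.hasFDerivAt
  · exact (continuousOn_fderiv_of_contMDiffOn_uncurry hU hF).comp
      (f := fun p : E × T => (σ p.2, p.1))
      ((hσ.comp continuousOn_snd fun p hp => hp.2).prodMk continuousOn_fst)
      fun p hp => ⟨hσS hp.2, hp.1⟩

end ParametricDerivative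

section Translate

variable {E : Type*} [NormedAddCommGroup E] [NormedSpace ℝ E]
  {G : Type*} [TopologicalSpace G] [ChartedSpace E G]
  {V : Type*} [NormedAddCommGroup V] [NormedSpace ℝ V]

theorem mdifferentiable_left_of_contMDiffOn {f : G → ℝ → V} {S : Set ℝ} {t : ℝ}
    (hf : ContMDiffOn (𝓘(ℝ, E).prod 𝓘(ℝ, ℝ)) 𝓘(ℝ, V) 1 (fun p : G × ℝ => f p.1 p.2)
      (univ ×ˢ S)) (ht : t ∈ S) : MDifferentiable 𝓘(ℝ, E) 𝓘(ℝ, V) (fun h => f h t) := by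
  have hcomp : ContMDiffOn 𝓘(ℝ, E) 𝓘(ℝ, V) 1 (fun h => f h t) univ :=
    hf.comp (contMDiff_id.prodMk contMDiff_const :
      ContMDiff 𝓘(ℝ, E) _ 1 fun h : G => (h, t)).contMDiffOn fun h _ => ⟨trivial, ht⟩
  exact (contMDiffOn_univ.1 hcomp).mdifferentiable (by simp)

variable [Group G]

/-- The derivative at `g` of a function on the group in the chart `x ↦ g * χ⁻¹ x`, for the
preferred chart `χ` at the identity. It is the coordinate form of `leftDeriv`. -/
noncomputable def chartDeriv (f : G → V) (g : G) : E →L[ℝ] V :=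
  fderiv ℝ (fun x : E => f (g * (chartAt E (1 : G)).symm x)) (chartOne E G)

variable [LieGroup 𝓘(ℝ, E) ∞ G]

theorem hasFDerivAt_chartDeriv {f : G → V} {g : G} (hf : MDifferentiableAt 𝓘(ℝ, E) 𝓘(ℝ, V) f g) :
    HasFDerivAt (fun x : E => f (g * (chartAt E (1 : G)).symm x)) (chartDeriv f g)
      (chartOne E G) := by
  have htranslate : MDifferentiableAt 𝓘(ℝ, E) 𝓘(ℝ, E)
      (fun x : E => g * (chartAt E (1 : G)).symm x) (chartOne E G) :=
    (hasMFDerivAt_mul_left g _).mdifferentiableAt.comp (chartOne E G)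
      hasMFDerivAt_chart_symm_chartOne.mdifferentiableAt
  have hcomp : MDifferentiableAt 𝓘(ℝ, E) 𝓘(ℝ, V)
      (fun x : E => f (g * (chartAt E (1 : G)).symm x)) (chartOne E G) :=
    MDifferentiableAt.comp (g := f) (chartOne E G)
      (by rwa [chart_symm_chartOne, mul_one]) htranslate
  exact hcomp.differentiableAt.hasFDerivAt

theorem leftDeriv_eq_chartDeriv [FiniteDimensional ℝ E] [T2Space G] {f : G → V} {g : G}
    (hf : MDifferentiableAt 𝓘(ℝ, E) 𝓘(ℝ, V) f g) (η : GroupLieAlgebra 𝓘(ℝ, E) G) :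
    leftDeriv f g η = chartDeriv (E := E) f g η :=
  leftDeriv_eq_of_hasFDerivAt (hasFDerivAt_chartDeriv hf) η

theorem contMDiffOn_mul_chart_symm :
    ContMDiffOn (𝓘(ℝ, E).prod 𝓘(ℝ, E)) 𝓘(ℝ, E) 1
      (fun q : G × E => q.1 * (chartAt E (1 : G)).symm q.2)
      (univ ×ˢ (chartAt E (1 : G)).target) := by
  have : LieGroup 𝓘(ℝ, E) 1 G := LieGroup.of_le (n := ∞) (mod_cast le_top)
  have hsymm : ContMDiffOn 𝓘(ℝ, E) 𝓘(ℝ, E) 1 (chartAt E (1 : G)).symm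
      (chartAt E (1 : G)).target := contMDiffOn_chart_symm
  exact contMDiff_fst.contMDiffOn.mul
    (hsymm.comp contMDiff_snd.contMDiffOn fun q hq => hq.2)

theorem contMDiffOn_translate {f : G → V} (hf : ContMDiff 𝓘(ℝ, E) 𝓘(ℝ, V) 1 f) :
    ContMDiffOn (𝓘(ℝ, E).prod 𝓘(ℝ, E)) 𝓘(ℝ, V) 1
      (Function.uncurry fun (g : G) (x : E) => f (g * (chartAt E (1 : G)).symm x))
      (univ ×ˢ (chartAt E (1 : G)).target) :=
  hf.comp_contMDiffOn contMDiffOn_mul_chart_symm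

end Translate

section RelativeField

variable {E : Type*} [NormedAddCommGroup E] [NormedSpace ℝ E]
  {G : Type*} [TopologicalSpace G] [ChartedSpace E G] [Group G]

/-- The velocity of `c⁻¹ c'` in the chart at the identity when `c` and `c'` follow `ċ = c f₁(c, t)`
and `ċ' = c' f(c', t)`, at a time where `c = g` and `c⁻¹ c'` has coordinates `x`. -/
noncomputable def relativeField (f₁ f : G → ℝ → E) (g : G) (t : ℝ) (x : E) : E :=
  leftFrame E G x (f (g * (chartAt E (1 : G)).symm x) t) - rightFrame E G x (f₁ g t)

theorem relativeField_insertedMode (f₁ f₂ : G → ℝ → E) (c : ℝ → G) (τ lam t : ℝ) (x : E) :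
    relativeField f₁ (insertedMode f₁ f₂ τ lam) (c t) t x =
      insertedMode (fun x t => relativeField f₁ f₁ (c t) t x)
        (fun x t => relativeField f₁ f₂ (c t) t x) τ lam x t := by
  unfold relativeField insertedMode
  split_ifs <;> rfl

variable [LieGroup 𝓘(ℝ, E) ∞ G]

theorem relativeField_chartOne (f₁ f : G → ℝ → E) (g : G) (t : ℝ) :
    relativeField f₁ f g t (chartOne E G) = f g t - f₁ g t := by
  simp [relativeField, leftFrame_chartOne, rightFrame_chartOne]

variable {f₁ f : G → ℝ → E} {S : Set ℝ} {t : ℝ}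

theorem contMDiffOn_relativeField
    (hf : ContMDiffOn (𝓘(ℝ, E).prod 𝓘(ℝ, ℝ)) 𝓘(ℝ, E) 1 (fun p : G × ℝ => f p.1 p.2)
      (univ ×ˢ S)) :
    ContMDiffOn ((𝓘(ℝ, E).prod 𝓘(ℝ, ℝ)).prod 𝓘(ℝ, E)) 𝓘(ℝ, E) 1
      (Function.uncurry fun q : G × ℝ => relativeField f f q.1 q.2)
      ((univ ×ˢ S) ×ˢ (chartAt E (1 : G)).target) := by
  have hleft : ContMDiffOn 𝓘(ℝ, E) 𝓘(ℝ, E →L[ℝ] E) 1 (leftFrame E G) (chartAt E (1 : G)).target :=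
    (contDiffOn_leftFrame.of_le (by simp)).contMDiffOn
  have hright : ContMDiffOn 𝓘(ℝ, E) 𝓘(ℝ, E →L[ℝ] E) 1 (rightFrame E G)
      (chartAt E (1 : G)).target := (contDiffOn_rightFrame.of_le (by simp)).contMDiffOn
  have hmul : ContMDiffOn ((𝓘(ℝ, E).prod 𝓘(ℝ, ℝ)).prod 𝓘(ℝ, E)) 𝓘(ℝ, E) 1
      (fun p : (G × ℝ) × E => p.1.1 * (chartAt E (1 : G)).symm p.2)
      ((univ ×ˢ S) ×ˢ (chartAt E (1 : G)).target) :=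
    contMDiffOn_mul_chart_symm.comp
      ((contMDiff_fst.comp contMDiff_fst).prodMk contMDiff_snd).contMDiffOn
      fun p hp => ⟨trivial, hp.2⟩
  have htime : ContMDiff ((𝓘(ℝ, E).prod 𝓘(ℝ, ℝ)).prod 𝓘(ℝ, E)) 𝓘(ℝ, ℝ) 1
      (fun p : (G × ℝ) × E => p.1.2) := contMDiff_snd.comp contMDiff_fst
  exact ((hleft.comp contMDiff_snd.contMDiffOn fun p hp => hp.2).clm_apply
      (hf.comp (hmul.prodMk htime.contMDiffOn) fun p hp => ⟨trivial, hp.1.2⟩)).sub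
    ((hright.comp contMDiff_snd.contMDiffOn fun p hp => hp.2).clm_apply
      (hf.comp contMDiff_fst.contMDiffOn fun p hp => hp.1))

theorem continuousWithinAt_relativeField {c : ℝ → G} (hc : ContinuousWithinAt c S t)
    (hf₁ : ContinuousWithinAt (fun s => f₁ (c s) s) S t)
    (hf : ContinuousWithinAt (fun p : G × ℝ => f p.1 p.2) (univ ×ˢ S) (c t, t)) :
    ContinuousWithinAt (Function.uncurry fun (x : E) s => relativeField f₁ f (c s) s x)
      (univ ×ˢ S) (chartOne E G, t) := by
  have : IsTopologicalGroup G := topologicalGroup_of_lieGroup 𝓘(ℝ, E) ∞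
  have hfst : ContinuousWithinAt Prod.fst (univ ×ˢ S) (chartOne E G, t) := continuousWithinAt_fst
  have hmaps : MapsTo Prod.snd (univ ×ˢ S : Set (E × ℝ)) S := fun p hp => hp.2
  have hbase : ContinuousWithinAt (fun p : E × ℝ => c p.2) (univ ×ˢ S) (chartOne E G, t) :=
    ContinuousWithinAt.comp (x := (chartOne E G, t)) hc continuousWithinAt_snd hmaps
  have hdrift : ContinuousWithinAt (fun p : E × ℝ => f₁ (c p.2) p.2) (univ ×ˢ S)
      (chartOne E G, t) :=
    ContinuousWithinAt.comp (x := (chartOne E G, t)) (g := fun s => f₁ (c s) s) hf₁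
      continuousWithinAt_snd hmaps
  have hsymm : ContinuousWithinAt (fun p : E × ℝ => (chartAt E (1 : G)).symm p.1) (univ ×ˢ S)
      (chartOne E G, t) :=
    ContinuousAt.comp_continuousWithinAt (x := (chartOne E G, t))
      ((chartAt E (1 : G)).symm.continuousAt chartOne_mem_target) hfst
  have hpoint : ContinuousWithinAt
      (fun p : E × ℝ => (c p.2 * (chartAt E (1 : G)).symm p.1, p.2)) (univ ×ˢ S)
      (chartOne E G, t) := (hbase.mul hsymm).prodMk continuousWithinAt_snd
  have hvalue := ContinuousWithinAt.comp (g := fun p : G × ℝ => f p.1 p.2) (t := univ ×ˢ S)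
    (by simpa using hf) hpoint fun p hp => ⟨trivial, hp.2⟩
  have hleft : ContinuousAt (leftFrame E G) (chartOne E G) :=
    (differentiableAt_leftFrame chartOne_mem_target).continuousAt
  have hright : ContinuousAt (rightFrame E G) (chartOne E G) :=
    (differentiableAt_rightFrame chartOne_mem_target).continuousAt
  exact ((ContinuousAt.comp_continuousWithinAt (x := (chartOne E G, t)) hleft hfst).clm_apply
      hvalue).sub
    ((ContinuousAt.comp_continuousWithinAt (x := (chartOne E G, t)) hright hfst).clm_apply
      hdrift)

theorem hasUniformFDerivAt_relativeField {c : ℝ → G} (hS : IsCompact S)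
    (hf : ContMDiffOn (𝓘(ℝ, E).prod 𝓘(ℝ, ℝ)) 𝓘(ℝ, E) 1 (fun p : G × ℝ => f p.1 p.2)
      (univ ×ˢ S)) (hc : ContinuousOn c S) :
    HasUniformFDerivAt (fun x t => relativeField f f (c t) t x)
      (fun t => fderiv ℝ (relativeField f f (c t) t) (chartOne E G)) (chartOne E G) S := by
  have : IsManifold 𝓘(ℝ, E) 1 G := IsManifold.of_le (n := ∞) (mod_cast le_top)
  exact hasUniformFDerivAt_of_contMDiffOn_uncurry (σ := fun t => (c t, t))
    (F := fun q : G × ℝ => relativeField f f q.1 q.2) (chartAt E (1 : G)).open_target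
    chartOne_mem_target (contMDiffOn_relativeField hf) hS (hc.prodMk continuousOn_id)
    fun t ht => ⟨trivial, ht⟩

theorem continuousOn_fderiv_relativeField {c : ℝ → G}
    (hf : ContMDiffOn (𝓘(ℝ, E).prod 𝓘(ℝ, ℝ)) 𝓘(ℝ, E) 1 (fun p : G × ℝ => f p.1 p.2)
      (univ ×ˢ S)) (hc : ContinuousOn c S) :
    ContinuousOn (fun t => fderiv ℝ (relativeField f f (c t) t) (chartOne E G)) S := by
  have : IsManifold 𝓘(ℝ, E) 1 G := IsManifold.of_le (n := ∞) (mod_cast le_top)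
  exact continuousOn_fderiv_comp_of_contMDiffOn_uncurry (σ := fun t => (c t, t))
    (F := fun q : G × ℝ => relativeField f f q.1 q.2) (chartAt E (1 : G)).open_target
    chartOne_mem_target (contMDiffOn_relativeField hf) (hc.prodMk continuousOn_id)
    fun t ht => ⟨trivial, ht⟩

theorem fderiv_relativeField_chartOne_apply {g : G}
    (hf : MDifferentiableAt 𝓘(ℝ, E) 𝓘(ℝ, E) (fun h => f h t) g) (v : E) :
    fderiv ℝ (relativeField f f g t) (chartOne E G) v =
      chartDeriv (fun h => f h t) g v + fderiv ℝ (leftFrame E G) (chartOne E G) v (f g t) -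
        fderiv ℝ (leftFrame E G) (chartOne E G) (f g t) v := by
  have hleft := (differentiableAt_leftFrame (chartOne_mem_target (G := G))).hasFDerivAt.clm_apply
    (hasFDerivAt_chartDeriv hf)
  have hright := (differentiableAt_rightFrame (chartOne_mem_target (G := G))).hasFDerivAt.clm_apply
    (hasFDerivAt_const (f g t) (chartOne E G))
  have hfield : HasFDerivAt (relativeField f f g t) _ (chartOne E G) := hleft.sub hright
  rw [hfield.fderiv]
  simp [leftFrame_chartOne, fderiv_rightFrame_chartOne]

theorem leftDeriv_sub_bracket_eq_fderiv_relativeField [FiniteDimensional ℝ E] [T2Space G]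
    {f : G → ℝ → GroupLieAlgebra 𝓘(ℝ, E) G} {g : G}
    (hf : MDifferentiableAt (M' := E) 𝓘(ℝ, E) 𝓘(ℝ, E) (fun h => f h t) g)
    (η : GroupLieAlgebra 𝓘(ℝ, E) G) :
    leftDeriv (fun h => f h t) g η - ⁅f g t, η⁆ =
      fderiv ℝ (relativeField (E := E) f f g t) (chartOne E G) η := by
  have hderiv : leftDeriv (fun h => f h t) g η =
      chartDeriv (E := E) (V := E) (fun h => f h t) g η :=
    leftDeriv_eq_chartDeriv (V := E) hf η
  rw [hderiv, bracket_eq_fderiv_leftFrame]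
  exact (sub_sub_eq_add_sub (α := E) _ _ _).trans
    (fderiv_relativeField_chartOne_apply (E := E) hf η).symm

end RelativeField

section Costate

theorem hasDerivWithinAt_of_forall_hasDerivWithinAt_apply {X : Type*} [NormedAddCommGroup X]
    [NormedSpace ℝ X] [FiniteDimensional ℝ X] {u : ℝ → X →L[ℝ] ℝ} {u' : X →L[ℝ] ℝ} {s : Set ℝ}
    {t : ℝ} (h : ∀ v, HasDerivWithinAt (fun r => u r v) (u' v) s t) :
    HasDerivWithinAt u u' s t := by
  let b := Module.finBasis ℝ X
  have hexpand (T : X →L[ℝ] ℝ) : T = ∑ i, T (b i) • (b.coord i).toContinuousLinearMap := by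
    ext v
    calc T v = T (∑ i, b.repr v i • b i) := by rw [b.sum_repr]
      _ = _ := by rw [map_sum]; simp [mul_comm]
  have hsum : HasDerivWithinAt (fun r => ∑ i, u r (b i) • (b.coord i).toContinuousLinearMap)
      (∑ i, u' (b i) • (b.coord i).toContinuousLinearMap) s t :=
    HasDerivWithinAt.fun_sum fun i _ =>
      HasDerivWithinAt.smul_const (F := X →L[ℝ] ℝ) (h (b i)) (b.coord i).toContinuousLinearMap
  rw [← hexpand u'] at hsum
  exact hsum.congr (fun r _ => hexpand (u r)) (hexpand (u t))

variable {E : Type*} [NormedAddCommGroup E] [NormedSpace ℝ E] [FiniteDimensional ℝ E]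
  {G : Type*} [TopologicalSpace G] [ChartedSpace E G] [Group G] [LieGroup 𝓘(ℝ, E) ∞ G] [T2Space G]
  {f : G → ℝ → GroupLieAlgebra 𝓘(ℝ, E) G} {L φ : G → ℝ} {a b : ℝ} {c : ℝ → G}

theorem isCostate_iff_hasDerivWithinAt
    (hf : ∀ t ∈ Icc a b, MDifferentiable (M' := E) 𝓘(ℝ, E) 𝓘(ℝ, E) (fun g => f g t))
    (hL : MDifferentiable 𝓘(ℝ, E) 𝓘(ℝ, ℝ) L) (hφ : MDifferentiableAt 𝓘(ℝ, E) 𝓘(ℝ, ℝ) φ (c b))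
    {ρ : ℝ → Module.Dual ℝ (GroupLieAlgebra 𝓘(ℝ, E) G)} {R : ℝ → E →L[ℝ] ℝ}
    (hρ : ∀ t (v : E), ρ t v = R t v) :
    IsCostate f L φ a b c ρ ↔
      (∀ t ∈ Icc a b, HasDerivWithinAt R
        (-((R t).comp (fderiv ℝ (relativeField (E := E) f f (c t) t) (chartOne E G)) +
          chartDeriv L (c t))) (Icc a b) t) ∧
      R b = chartDeriv φ (c b) := by
  have hcurve : ∀ η : E, (fun t => ρ t η) = fun t => R t η := fun η => funext fun t => hρ t η
  have hvelocity : ∀ s ∈ Icc a b, ∀ η : GroupLieAlgebra 𝓘(ℝ, E) G,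
      -(ρ s (leftDeriv (fun x => f x s) (c s) η - ⁅f (c s) s, η⁆)) - leftDeriv L (c s) η =
        (-((R s).comp (fderiv ℝ (relativeField (E := E) f f (c s) s) (chartOne E G)) +
          chartDeriv (E := E) L (c s)) : E →L[ℝ] ℝ) η := by
    intro s hs η
    rw [leftDeriv_sub_bracket_eq_fderiv_relativeField (hf s hs _),
      leftDeriv_eq_chartDeriv (hL _), hρ]
    exact (neg_add' _ _).symm
  constructor
  · rintro ⟨hode, hterminal⟩
    refine ⟨fun t ht => hasDerivWithinAt_of_forall_hasDerivWithinAt_apply fun v => ?_, ?_⟩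
    · exact (hcurve v) ▸ (hvelocity t ht v) ▸ hode t ht v
    · ext v
      exact (hρ b v).symm.trans ((hterminal v).trans (leftDeriv_eq_chartDeriv hφ v))
  · rintro ⟨hode, hterminal⟩
    refine ⟨fun t ht η => ?_, fun η => ?_⟩
    · rw [hvelocity t ht]
      have happly := (hode t ht).clm_apply (hasDerivWithinAt_const (F := E) t (Icc a b) η)
      simp only [map_zero, add_zero] at happly
      exact (hcurve η).symm ▸ happly
    · rw [leftDeriv_eq_chartDeriv hφ, ← hterminal]
      exact hρ b η

theorem exists_isCostate (hab : a ≤ b)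
    (hf : ContMDiffOn (M' := E) (𝓘(ℝ, E).prod 𝓘(ℝ, ℝ)) 𝓘(ℝ, E) 1 (fun p : G × ℝ => f p.1 p.2)
      (univ ×ˢ Icc a b))
    (hL : ContMDiff 𝓘(ℝ, E) 𝓘(ℝ, ℝ) 1 L) (hφ : MDifferentiableAt 𝓘(ℝ, E) 𝓘(ℝ, ℝ) φ (c b))
    (hc : ContinuousOn c (Icc a b)) :
    ∃ ρ : ℝ → Module.Dual ℝ (GroupLieAlgebra 𝓘(ℝ, E) G), IsCostate f L φ a b c ρ := by
  have : IsManifold 𝓘(ℝ, E) 1 G := IsManifold.of_le (n := ∞) (mod_cast le_top)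
  have hlin : ContinuousOn
      (fun t => fderiv ℝ (relativeField (E := E) f f (c t) t) (chartOne E G)) (Icc a b) :=
    continuousOn_fderiv_relativeField (E := E) hf hc
  have hgrad : ContinuousOn (fun t => chartDeriv (E := E) L (c t)) (Icc a b) :=
    continuousOn_fderiv_comp_of_contMDiffOn_uncurry (chartAt E (1 : G)).open_target
      chartOne_mem_target (contMDiffOn_translate hL) hc fun t _ => trivial
  obtain ⟨R, hterminal, hode⟩ := exists_hasDerivWithinAt_affine hab
    (((ContinuousLinearMap.compL ℝ E E ℝ).flip.continuous.comp_continuousOn hlin).neg)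
    hgrad.neg (chartDeriv (E := E) φ (c b))
  refine ⟨fun t => (R t : E →ₗ[ℝ] ℝ), (isCostate_iff_hasDerivWithinAt
    (fun t ht => mdifferentiable_left_of_contMDiffOn (V := E) hf ht) (hL.mdifferentiable (by simp))
    hφ fun t v => rfl).2 ⟨fun t ht => ?_, hterminal⟩⟩
  rw [neg_add]
  exact hode t ht

end Costate

section Trajectory

variable {E : Type*} [NormedAddCommGroup E] [NormedSpace ℝ E]
  {G : Type*} [TopologicalSpace G] [ChartedSpace E G] [Group G]

namespace IsTrajectory

variable {f f' f₁ f₂ : G → ℝ → E} {a b τ lam : ℝ} {g₀ : G} {c c' : ℝ → G}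

theorem mono {a' b' : ℝ} (hc : IsTrajectory f a b g₀ c) (ha : a ≤ a') (hb : b' ≤ b) :
    IsTrajectory f a' b' (c a') c where
  init := rfl
  cont := hc.cont.mono (Icc_subset_Icc ha hb)
  ode t ht := hc.ode t ⟨ha.trans ht.1, ht.2.trans_le hb⟩

theorem congr (hc : IsTrajectory f a b g₀ c) (h : ∀ t ∈ Ico a b, f (c t) t = f' (c t) t) :
    IsTrajectory f' a b g₀ c where
  init := hc.init
  cont := hc.cont
  ode t ht := h t ht ▸ hc.ode t ht

variable [LieGroup 𝓘(ℝ, E) ∞ G]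

theorem continuousOn_inv_mul (hc : IsTrajectory f₁ a b g₀ c) (hc' : IsTrajectory f a b g₀ c') :
    ContinuousOn (fun t => (c t)⁻¹ * c' t) (Icc a b) := by
  have : IsTopologicalGroup G := topologicalGroup_of_lieGroup 𝓘(ℝ, E) ∞
  exact hc.cont.inv.mul hc'.cont

theorem hasDerivWithinAt_chart_inv_mul {t : ℝ} (hc : IsTrajectory f₁ a b g₀ c)
    (hc' : IsTrajectory f a b g₀ c') (ht : t ∈ Ico a b)
    (hmem : (c t)⁻¹ * c' t ∈ (chartAt E (1 : G)).source) :
    HasDerivWithinAt (fun u => chartAt E (1 : G) ((c u)⁻¹ * c' u))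
      (relativeField f₁ f (c t) t (chartAt E (1 : G) ((c t)⁻¹ * c' t))) (Ici t) t := by
  have hquot := HasLeftLogDerivWithinAt.hasDerivWithinAt_chart_inv_mul (E := E) (hc.ode t ht)
    (hc'.ode t ht) (uniqueDiffWithinAt_Ici t) self_mem_Ici hmem
  rw [relativeField, (chartAt E (1 : G)).left_inv hmem, mul_inv_cancel_left]
  exact hquot

theorem isNeedleCurve (hc : IsTrajectory f₁ τ b g₀ c)
    (hc' : IsTrajectory (insertedMode f₁ f₂ τ lam) τ b g₀ c')
    (hmem : MapsTo (fun t => (c t)⁻¹ * c' t) (Icc τ b) (chartAt E (1 : G)).source) :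
    IsNeedleCurve (fun x t => relativeField f₁ f₁ (c t) t x)
      (fun x t => relativeField f₁ f₂ (c t) t x) τ b lam (chartOne E G)
      (fun t => chartAt E (1 : G) ((c t)⁻¹ * c' t)) where
  init := by simp [hc.init, hc'.init, chartOne]
  cont := (chartAt E (1 : G)).continuousOn.comp (hc.continuousOn_inv_mul hc') hmem
  ode t ht := by
    rw [← relativeField_insertedMode]
    exact hc.hasDerivWithinAt_chart_inv_mul hc' ht (hmem ⟨ht.1, ht.2.le⟩)

section Displacement

variable {K M r : ℝ}

theorem norm_chart_inv_mul_le (hc : IsTrajectory f₁ τ b g₀ c)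
    (hc' : IsTrajectory (insertedMode f₁ f₂ τ lam) τ b g₀ c') {t : ℝ} (ht : t ∈ Icc τ b)
    (hK : 0 ≤ K) (hM : 0 ≤ M) (hlam : 0 ≤ lam)
    (h₁ : ∀ x ∈ Metric.ball (chartOne E G) r, ∀ t ∈ Icc τ b,
      ‖relativeField f₁ f₁ (c t) t x‖ ≤ K * ‖x - chartOne E G‖)
    (h₂ : ∀ x ∈ Metric.ball (chartOne E G) r, ∀ t ∈ Icc τ b, t < τ + lam →
      ‖relativeField f₁ f₂ (c t) t x‖ ≤ M)
    (hmem : MapsTo (fun t => (c t)⁻¹ * c' t) (Icc τ b)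
      ((chartAt E (1 : G)).source ∩ chartAt E (1 : G) ⁻¹' Metric.ball (chartOne E G) r)) :
    ‖chartAt E (1 : G) ((c t)⁻¹ * c' t) - chartOne E G‖ ≤ M * lam * Real.exp (K * (t - τ)) :=
  (hc.isNeedleCurve hc' fun _ ht => (hmem ht).1).norm_sub_le hK hM hlam
    (fun t ht => h₁ _ (hmem ⟨ht.1, ht.2.le⟩).2 t ⟨ht.1, ht.2.le⟩)
    (fun t ht => h₂ _ (hmem ⟨ht.1, ht.2.le⟩).2 t ⟨ht.1, ht.2.le⟩) ht

variable [FiniteDimensional ℝ E] [T2Space G]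

theorem mapsTo_source_inter_ball (hc : IsTrajectory f₁ τ b g₀ c)
    (hc' : IsTrajectory (insertedMode f₁ f₂ τ lam) τ b g₀ c') (hK : 0 ≤ K) (hM : 0 ≤ M)
    (hlam : 0 ≤ lam) (hr : Metric.ball (chartOne E G) r ⊆ (chartAt E (1 : G)).target)
    (hsmall : M * lam * Real.exp (K * (b - τ)) < r)
    (h₁ : ∀ x ∈ Metric.ball (chartOne E G) r, ∀ t ∈ Icc τ b,
      ‖relativeField f₁ f₁ (c t) t x‖ ≤ K * ‖x - chartOne E G‖)
    (h₂ : ∀ x ∈ Metric.ball (chartOne E G) r, ∀ t ∈ Icc τ b, t < τ + lam →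
      ‖relativeField f₁ f₂ (c t) t x‖ ≤ M) :
    MapsTo (fun t => (c t)⁻¹ * c' t) (Icc τ b)
      ((chartAt E (1 : G)).source ∩ chartAt E (1 : G) ⁻¹' Metric.ball (chartOne E G) r) := by
  have : ProperSpace E := FiniteDimensional.proper ℝ E
  set r' := M * lam * Real.exp (K * (b - τ))
  have hr' : Metric.closedBall (chartOne E G) r' ⊆ Metric.ball (chartOne E G) r :=
    Metric.closedBall_subset_ball hsmall
  have hclosed : IsClosed ((chartAt E (1 : G)).symm '' Metric.closedBall (chartOne E G) r') :=
    ((isCompact_closedBall _ _).image_of_continuousOn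
      ((chartAt E (1 : G)).continuousOn_symm.mono (hr'.trans hr))).isClosed
  refine mapsTo_Icc_of_forall_mapsTo_Ico hclosed
    ((chartAt E (1 : G)).isOpen_inter_preimage Metric.isOpen_ball) ?_
    (hc.continuousOn_inv_mul hc') ?_ fun s hs hW t ht => ?_
  · rintro _ ⟨x, hx, rfl⟩
    exact ⟨(chartAt E (1 : G)).map_target (hr (hr' hx)),
      by simpa only [mem_preimage, (chartAt E (1 : G)).right_inv (hr (hr' hx))] using hr' hx⟩
  · have hrpos : 0 < r := lt_of_le_of_lt (by positivity) hsmall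
    simpa [hc.init, hc'.init, chartOne] using hrpos
  · have htb : t ≤ b := ht.2.le.trans hs.2
    have hWt : MapsTo (fun t => (c t)⁻¹ * c' t) (Icc τ t) _ :=
      hW.mono_left (Icc_subset_Ico_right ht.2)
    have hinit : c' τ = c τ := hc'.init.trans hc.init.symm
    have hbound := (hc.mono le_rfl htb).norm_chart_inv_mul_le (hinit ▸ hc'.mono le_rfl htb)
      (right_mem_Icc.2 ht.1) hK hM hlam (fun x hx s hs => h₁ x hx s ⟨hs.1, hs.2.trans htb⟩)
      (fun x hx s hs => h₂ x hx s ⟨hs.1, hs.2.trans htb⟩) hWt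
    refine ⟨_, mem_closedBall_iff_norm.2 (hbound.trans ?_), (chartAt E (1 : G)).left_inv (hW ht).1⟩
    simp only [r']
    gcongr

end Displacement

end IsTrajectory

variable [LieGroup 𝓘(ℝ, E) ∞ G] {f₁ f₂ : G → ℝ → E} {a b τ : ℝ} {g₀ : G} {c c' : ℝ → G}

theorem exists_norm_relativeField_le
    (hf : ContMDiffOn (𝓘(ℝ, E).prod 𝓘(ℝ, ℝ)) 𝓘(ℝ, E) 1 (fun p : G × ℝ => f₁ p.1 p.2)
      (univ ×ˢ Icc a b)) (hc : ContinuousOn c (Icc a b)) :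
    ∃ K ≥ 0, ∀ᶠ x in 𝓝 (chartOne E G), ∀ t ∈ Icc a b,
      ‖relativeField f₁ f₁ (c t) t x‖ ≤ K * ‖x - chartOne E G‖ := by
  simpa only [relativeField_chartOne, sub_self, sub_zero] using
    (hasUniformFDerivAt_relativeField isCompact_Icc hf hc).exists_norm_sub_le isCompact_Icc
      (continuousOn_fderiv_relativeField hf hc)

theorem exists_ball_norm_relativeField_le (hτ : τ ≤ b)
    (hf₁ : ContMDiffOn (𝓘(ℝ, E).prod 𝓘(ℝ, ℝ)) 𝓘(ℝ, E) 1 (fun p : G × ℝ => f₁ p.1 p.2)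
      (univ ×ˢ Icc τ b))
    (hf₂ : ContinuousWithinAt (fun p : G × ℝ => f₂ p.1 p.2) (univ ×ˢ Icc τ b) (c τ, τ))
    (hc : ContinuousOn c (Icc τ b)) :
    ∃ K ≥ 0, ∃ M ≥ 0, ∃ r > 0, ∃ δ > 0,
      Metric.ball (chartOne E G) r ⊆ (chartAt E (1 : G)).target ∧
      (∀ x ∈ Metric.ball (chartOne E G) r, ∀ t ∈ Icc τ b,
        ‖relativeField f₁ f₁ (c t) t x‖ ≤ K * ‖x - chartOne E G‖) ∧
      ∀ x ∈ Metric.ball (chartOne E G) r, ∀ t ∈ Icc τ b, t < τ + δ →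
        ‖relativeField f₁ f₂ (c t) t x‖ ≤ M := by
  have hτmem : τ ∈ Icc τ b := left_mem_Icc.2 hτ
  have hF₂ := continuousWithinAt_relativeField (hc τ hτmem)
    ((hf₁.continuousOn.comp (hc.prodMk continuousOn_id) fun t ht => ⟨trivial, ht⟩) τ hτmem) hf₂
  obtain ⟨δ, hδ, hδbound⟩ := exists_forall_lt_add_of_continuousWithinAt hF₂ one_pos
  obtain ⟨K, hK, hKbound⟩ := exists_norm_relativeField_le hf₁ hc
  obtain ⟨r, hr, hball⟩ := Metric.eventually_nhds_iff_ball.1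
    ((hKbound.and hδbound).and ((chartAt E (1 : G)).open_target.mem_nhds chartOne_mem_target))
  refine ⟨K, hK, ‖relativeField f₁ f₂ (c τ) τ (chartOne E G)‖ + 1, by positivity, r, hr, δ, hδ,
    fun x hx => (hball x hx).2, fun x hx => (hball x hx).1.1, fun x hx t ht htδ => ?_⟩
  have hdist := (hball x hx).1.2 t ht htδ
  rw [dist_eq_norm] at hdist
  exact (norm_le_norm_add_norm_sub' _ _).trans (add_le_add le_rfl hdist)

variable [FiniteDimensional ℝ E] [T2Space G]

theorem IsTrajectory.eqOn
    (hf : ContMDiffOn (𝓘(ℝ, E).prod 𝓘(ℝ, ℝ)) 𝓘(ℝ, E) 1 (fun p : G × ℝ => f₁ p.1 p.2)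
      (univ ×ˢ Icc a b))
    (hc : IsTrajectory f₁ a b g₀ c) (hc' : IsTrajectory f₁ a b g₀ c') : EqOn c' c (Icc a b) := by
  obtain ⟨K, hK, hKbound⟩ := exists_norm_relativeField_le hf hc.cont
  obtain ⟨r, hr, hball⟩ := Metric.eventually_nhds_iff_ball.1
    (hKbound.and ((chartAt E (1 : G)).open_target.mem_nhds chartOne_mem_target))
  rw [← insertedMode_zero f₁ f₁ a] at hc'
  have h₁ : ∀ x ∈ Metric.ball (chartOne E G) r, ∀ t ∈ Icc a b,
      ‖relativeField f₁ f₁ (c t) t x‖ ≤ K * ‖x - chartOne E G‖ := fun x hx => (hball x hx).1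
  have hempty : ∀ {t}, a ≤ t → ¬t < a + 0 := fun ht => by simpa using ht
  have hmem := hc.mapsTo_source_inter_ball hc' hK le_rfl le_rfl (fun x hx => (hball x hx).2)
    (by simpa using hr) h₁ fun x _ t ht hta => absurd hta (hempty ht.1)
  intro t ht
  have hbound := hc.norm_chart_inv_mul_le hc' ht hK (le_refl 0) le_rfl h₁
    (fun x _ t ht hta => absurd hta (hempty ht.1)) hmem
  rw [mul_zero, zero_mul, norm_le_zero_iff, sub_eq_zero] at hbound
  exact (inv_mul_eq_one.1
    ((chartAt E (1 : G)).injOn (hmem ht).1 (mem_chart_source E 1) hbound)).symm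

theorem exists_isNeedleVariation (hτ : τ < b)
    (hf₁ : ContMDiffOn (𝓘(ℝ, E).prod 𝓘(ℝ, ℝ)) 𝓘(ℝ, E) 1 (fun p : G × ℝ => f₁ p.1 p.2)
      (univ ×ˢ Icc τ b))
    (hf₂ : ContinuousWithinAt (fun p : G × ℝ => f₂ p.1 p.2) (univ ×ˢ Icc τ b) (c τ, τ))
    (hc : IsTrajectory f₁ τ b g₀ c) {γ : ℝ → ℝ → G}
    (hγ : ∀ᶠ lam in 𝓝[>] (0 : ℝ), IsTrajectory (insertedMode f₁ f₂ τ lam) τ b g₀ (γ lam)) :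
    (∀ᶠ lam in 𝓝[>] (0 : ℝ),
      MapsTo (fun t => (c t)⁻¹ * γ lam t) (Icc τ b) (chartAt E (1 : G)).source) ∧
    ∃ C, IsNeedleVariation (fun x t => relativeField f₁ f₁ (c t) t x)
      (fun x t => relativeField f₁ f₂ (c t) t x) τ b (chartOne E G)
      (fun lam t => chartAt E (1 : G) ((c t)⁻¹ * γ lam t)) C := by
  obtain ⟨K, hK, M, hM, r, hr, δ, hδ, htarget, h₁, h₂⟩ :=
    exists_ball_norm_relativeField_le hτ.le hf₁ hf₂ hc.cont
  have hsmall : Tendsto (fun lam : ℝ => M * lam * Real.exp (K * (b - τ))) (𝓝[>] 0) (𝓝 0) :=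
    (Continuous.tendsto' (by fun_prop) 0 0 (by simp)).mono_left nhdsWithin_le_nhds
  have hgood : ∀ᶠ lam in 𝓝[>] (0 : ℝ),
      MapsTo (fun t => (c t)⁻¹ * γ lam t) (Icc τ b) (chartAt E (1 : G)).source ∧
      ∀ t ∈ Icc τ b, ‖chartAt E (1 : G) ((c t)⁻¹ * γ lam t) - chartOne E G‖ ≤
        M * Real.exp (K * (b - τ)) * lam := by
    filter_upwards [hγ, hsmall.eventually_lt_const hr, nhdsWithin_le_nhds (Iio_mem_nhds hδ),
      self_mem_nhdsWithin] with lam hγlam hr' (hlamδ : lam < δ) (hlam : 0 < lam)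
    have h₂' : ∀ x ∈ Metric.ball (chartOne E G) r, ∀ t ∈ Icc τ b, t < τ + lam →
        ‖relativeField f₁ f₂ (c t) t x‖ ≤ M := fun x hx t ht htl => h₂ x hx t ht (by linarith)
    have hmem := hc.mapsTo_source_inter_ball hγlam hK hM hlam.le htarget hr' h₁ h₂'
    refine ⟨fun t ht => (hmem ht).1, fun t ht => ?_⟩
    calc _ ≤ M * lam * Real.exp (K * (t - τ)) :=
          hc.norm_chart_inv_mul_le hγlam ht hK hM hlam.le h₁ h₂' hmem
      _ ≤ M * lam * Real.exp (K * (b - τ)) := by gcongr; exact ht.2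
      _ = M * Real.exp (K * (b - τ)) * lam := by ring
  refine ⟨hgood.mono fun _ h => h.1, M * Real.exp (K * (b - τ)), ?_, hgood.mono fun _ h => h.2⟩
  filter_upwards [hγ, hgood] with lam hγlam hlam
  exact hc.isNeedleCurve hγlam hlam.1

end Trajectory

section Cost

theorem cost_sub_cost {G : Type*} {L : G → ℝ} (φ : G → ℝ) {a b τ : ℝ} (hτ : a ≤ τ) (hτb : τ ≤ b)
    {c c' : ℝ → G} (heq : EqOn c' c (Icc a τ))
    (hc' : ContinuousOn (fun t => L (c' t)) (Icc a b))
    (hc : ContinuousOn (fun t => L (c t)) (Icc a b)) :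
    cost L φ a b c' - cost L φ a b c =
      (∫ t in τ..b, (L (c' t) - L (c t))) + (φ (c' b) - φ (c b)) := by
  have hintegrable : ∀ {u : ℝ → ℝ} {a' b' : ℝ}, a' ≤ b' → Icc a' b' ⊆ Icc a b →
      ContinuousOn u (Icc a b) → IntervalIntegrable u volume a' b' := fun hle hsub hu =>
    ContinuousOn.intervalIntegrable_of_Icc hle (hu.mono hsub)
  have hbefore : ∫ t in a..τ, (L (c' t) - L (c t)) = 0 :=
    intervalIntegral.integral_zero_ae (ae_of_all _ fun t ht => by
      rw [uIoc_of_le hτ] at ht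
      rw [heq ⟨ht.1.le, ht.2⟩, sub_self])
  have hdiff : ContinuousOn (fun t => L (c' t) - L (c t)) (Icc a b) := hc'.sub hc
  have hsplit := intervalIntegral.integral_add_adjacent_intervals
    (hintegrable hτ (Icc_subset_Icc_right hτb) hdiff)
    (hintegrable hτb (Icc_subset_Icc_left hτ) hdiff)
  rw [hbefore, zero_add, intervalIntegral.integral_sub
    (hintegrable (hτ.trans hτb) subset_rfl hc')
    (hintegrable (hτ.trans hτb) subset_rfl hc)] at hsplit
  rw [hsplit, cost, cost]
  ring

variable {E : Type*} [NormedAddCommGroup E] [NormedSpace ℝ E]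
  {G : Type*} [TopologicalSpace G] [ChartedSpace E G] [Group G]
  {f₁ f₂ : G → ℝ → E} {L φ : G → ℝ} {a b τ : ℝ} {g₀ : G} {c c' : ℝ → G} {R : ℝ → E →L[ℝ] ℝ}

theorem cost_sub_cost_eq_adjointCost (hτ : a ≤ τ) (hτb : τ ≤ b) (heq : EqOn c' c (Icc a τ))
    (hc' : ContinuousOn (fun t => L (c' t)) (Icc a b))
    (hc : ContinuousOn (fun t => L (c t)) (Icc a b))
    (hmem : MapsTo (fun t => (c t)⁻¹ * c' t) (Icc τ b) (chartAt E (1 : G)).source) :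
    cost L φ a b c' - cost L φ a b c =
      adjointCost R (fun x t => L (c t * (chartAt E (1 : G)).symm x)) τ (chartOne E G)
        (fun t => chartAt E (1 : G) ((c t)⁻¹ * c' t)) b +
      (φ (c b * (chartAt E (1 : G)).symm (chartAt E (1 : G) ((c b)⁻¹ * c' b))) -
        φ (c b * (chartAt E (1 : G)).symm (chartOne E G)) -
        R b (chartAt E (1 : G) ((c b)⁻¹ * c' b) - chartOne E G)) := by
  have hinv : ∀ t ∈ Icc τ b,
      c t * (chartAt E (1 : G)).symm (chartAt E (1 : G) ((c t)⁻¹ * c' t)) = c' t := fun t ht => by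
    rw [(chartAt E (1 : G)).left_inv (hmem ht), mul_inv_cancel_left]
  have hcongr : ∫ t in τ..b, (L (c t * (chartAt E (1 : G)).symm
      (chartAt E (1 : G) ((c t)⁻¹ * c' t))) - L (c t)) = ∫ t in τ..b, (L (c' t) - L (c t)) :=
    intervalIntegral.integral_congr fun t ht => by
      rw [uIcc_of_le hτb] at ht
      simp only [hinv t ht]
  rw [cost_sub_cost φ hτ hτb heq hc' hc, adjointCost]
  simp only [chart_symm_chartOne, mul_one]
  rw [hcongr, hinv b (right_mem_Icc.2 hτb)]
  ring

variable [LieGroup 𝓘(ℝ, E) ∞ G]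

theorem continuousOn_translate_uncurry {S : Set ℝ} (hL : Continuous L) (hc : ContinuousOn c S) :
    ContinuousOn (Function.uncurry fun (x : E) t => L (c t * (chartAt E (1 : G)).symm x))
      ((chartAt E (1 : G)).target ×ˢ S) := by
  have : IsTopologicalGroup G := topologicalGroup_of_lieGroup 𝓘(ℝ, E) ∞
  exact hL.comp_continuousOn ((hc.comp continuousOn_snd fun p hp => hp.2).mul
    ((chartAt E (1 : G)).continuousOn_symm.comp continuousOn_fst fun p hp => hp.1))

theorem hasUniformFDerivAt_hamiltonian {S : Set ℝ} (hS : IsCompact S)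
    (hf₁ : ContMDiffOn (𝓘(ℝ, E).prod 𝓘(ℝ, ℝ)) 𝓘(ℝ, E) 1 (fun p : G × ℝ => f₁ p.1 p.2)
      (univ ×ˢ S))
    (hL : ContMDiff 𝓘(ℝ, E) 𝓘(ℝ, ℝ) 1 L) (hc : ContinuousOn c S) (hR : ContinuousOn R S) :
    HasUniformFDerivAt
      (fun x t => R t (relativeField f₁ f₁ (c t) t x) + L (c t * (chartAt E (1 : G)).symm x))
      (fun t => (R t).comp (fderiv ℝ (relativeField f₁ f₁ (c t) t) (chartOne E G)) +
        chartDeriv L (c t)) (chartOne E G) S := by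
  have : IsManifold 𝓘(ℝ, E) 1 G := IsManifold.of_le (n := ∞) (mod_cast le_top)
  obtain ⟨C, hC⟩ := hS.exists_bound_of_continuousOn hR
  exact ((hasUniformFDerivAt_relativeField hS hf₁ hc).clm_apply hC).add
    (hasUniformFDerivAt_of_contMDiffOn_uncurry (σ := c)
      (F := fun g x => L (g * (chartAt E (1 : G)).symm x)) (chartAt E (1 : G)).open_target
      chartOne_mem_target (contMDiffOn_translate hL) hS hc fun _ _ => trivial)

variable [FiniteDimensional ℝ E] [T2Space G]

theorem IsTrajectory.eqOn_of_insertedMode {lam : ℝ} (hτb : τ ≤ b)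
    (hf₁ : ContMDiffOn (𝓘(ℝ, E).prod 𝓘(ℝ, ℝ)) 𝓘(ℝ, E) 1 (fun p : G × ℝ => f₁ p.1 p.2)
      (univ ×ˢ Icc a b))
    (hc : IsTrajectory f₁ a b g₀ c) (hc' : IsTrajectory (insertedMode f₁ f₂ τ lam) a b g₀ c') :
    EqOn c' c (Icc a τ) := by
  have hc'τ := (hc'.mono le_rfl hτb).congr (f' := f₁) fun t ht =>
    if_neg fun h => ht.2.not_ge h.1
  have hcτ := hc.mono le_rfl hτb
  rw [hc.init] at hcτ
  rw [hc'.init] at hc'τ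
  exact hcτ.eqOn (hf₁.mono (prod_mono subset_rfl (Icc_subset_Icc_right hτb))) hc'τ

theorem hasDerivWithinAt_cost (hτ : a ≤ τ) (hτb : τ < b)
    (hf₁ : ContMDiffOn (𝓘(ℝ, E).prod 𝓘(ℝ, ℝ)) 𝓘(ℝ, E) 1 (fun p : G × ℝ => f₁ p.1 p.2)
      (univ ×ˢ Icc a b)) {γ : ℝ → ℝ → G}
    (hf₂ : ContinuousWithinAt (fun p : G × ℝ => f₂ p.1 p.2) (univ ×ˢ Icc τ b) (γ 0 τ, τ))
    (hL : ContMDiff 𝓘(ℝ, E) 𝓘(ℝ, ℝ) 1 L) (hφ : MDifferentiableAt 𝓘(ℝ, E) 𝓘(ℝ, ℝ) φ (γ 0 b))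
    (hc : IsTrajectory f₁ a b g₀ (γ 0))
    (hγ : ∀ᶠ lam in 𝓝[>] (0 : ℝ), IsTrajectory (insertedMode f₁ f₂ τ lam) a b g₀ (γ lam))
    (hR : ∀ t ∈ Icc a b, HasDerivWithinAt R
      (-((R t).comp (fderiv ℝ (relativeField f₁ f₁ (γ 0 t) t) (chartOne E G)) +
        chartDeriv L (γ 0 t))) (Icc a b) t)
    (hRb : R b = chartDeriv φ (γ 0 b)) :
    HasDerivWithinAt (fun lam => cost L φ a b (γ lam))
      (R τ (f₂ (γ 0 τ) τ - f₁ (γ 0 τ) τ)) (Ici 0) 0 := by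
  have hsub : Icc τ b ⊆ Icc a b := Icc_subset_Icc_left hτ
  have hτmem : τ ∈ Icc τ b := left_mem_Icc.2 hτb.le
  have hf₁τ := hf₁.mono (prod_mono (subset_refl univ) hsub)
  have hcτ := hc.mono hτ le_rfl
  have hRτ : ContinuousOn R (Icc τ b) := fun t ht => ((hR t (hsub ht)).continuousWithinAt).mono hsub
  have heq : ∀ᶠ lam in 𝓝[>] (0 : ℝ), EqOn (γ lam) (γ 0) (Icc a τ) :=
    hγ.mono fun lam hγlam => hc.eqOn_of_insertedMode hτb.le hf₁ hγlam
  obtain ⟨hmem, C, hvar⟩ := exists_isNeedleVariation hτb hf₁τ hf₂ hcτ <|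
    (hγ.and heq).mono fun lam h => h.2 ⟨hτ, le_rfl⟩ ▸ h.1.mono hτ le_rfl
  have hdrift : ContinuousWithinAt (fun t => f₁ (γ 0 t) t) (Icc τ b) τ :=
    (hf₁τ.continuousOn.comp (hcτ.cont.prodMk continuousOn_id) fun t ht => ⟨trivial, ht⟩) τ hτmem
  have hrun := hvar.isLittleO_adjointCost hτb
    (fun t _ => by rw [relativeField_chartOne, sub_self])
    (continuousWithinAt_relativeField (hcτ.cont τ hτmem) hdrift
      (hf₁τ.continuousOn _ ⟨trivial, hτmem⟩))
    (continuousWithinAt_relativeField (hcτ.cont τ hτmem) hdrift hf₂)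
    ((chartAt E (1 : G)).open_target.mem_nhds chartOne_mem_target)
    (continuousOn_translate_uncurry hL.continuous hcτ.cont)
    (hasUniformFDerivAt_hamiltonian isCompact_Icc hf₁τ hL hcτ.cont hRτ)
    fun t ht => (hR t (hsub ht)).mono hsub
  have hterminal := hvar.isLittleO_comp hτb.le (hRb ▸ hasFDerivAt_chartDeriv hφ)
  rw [← hasDerivWithinAt_Ioi_iff_Ici, hasDerivWithinAt_iff_isLittleO]
  refine (hrun.add hterminal).congr' ?_ (Eventually.of_forall fun lam => (sub_zero lam).symm)
  filter_upwards [hγ, heq, hmem] with lam hγlam heq hmem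
  rw [cost_sub_cost_eq_adjointCost (R := R) hτ hτb.le heq
    (hL.continuous.comp_continuousOn hγlam.cont) (hL.continuous.comp_continuousOn hc.cont) hmem,
    relativeField_chartOne, sub_zero]
  ring

end Cost

end LieSwitch

theorem corollary1_general {E : Type*} [NormedAddCommGroup E] [NormedSpace ℝ E]
    [FiniteDimensional ℝ E] {G : Type*} [TopologicalSpace G] [ChartedSpace E G] [Group G]
    [LieGroup 𝓘(ℝ, E) ∞ G] [T2Space G]
    (f₁ f₂ : G → ℝ → GroupLieAlgebra 𝓘(ℝ, E) G) (L φ : G → ℝ)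
    (T₀ TN τ₀ : ℝ) (hT₀ : T₀ ≤ τ₀) (hTN : τ₀ < TN)
    (hf₁ : ContMDiffOn (M' := E) (𝓘(ℝ, E).prod 𝓘(ℝ, ℝ)) 𝓘(ℝ, E) 1
      (fun p : G × ℝ => f₁ p.1 p.2) (univ ×ˢ Icc T₀ TN))
    (g₀ : G) (γ : ℝ → ℝ → G)
    (hf₂ : ContinuousWithinAt (fun p : G × ℝ => (f₂ p.1 p.2 : E)) (univ ×ˢ Icc τ₀ TN) (γ 0 τ₀, τ₀))
    (hL : ContMDiff 𝓘(ℝ, E) 𝓘(ℝ, ℝ) 1 L) (hφ : MDifferentiableAt 𝓘(ℝ, E) 𝓘(ℝ, ℝ) φ (γ 0 TN))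
    (hγ : ∀ᶠ lam in 𝓝[≥] (0 : ℝ),
      LieSwitch.IsTrajectory (LieSwitch.insertedMode f₁ f₂ τ₀ lam) T₀ TN g₀ (γ lam)) :
    (∃ ρ : ℝ → Module.Dual ℝ (GroupLieAlgebra 𝓘(ℝ, E) G),
      LieSwitch.IsCostate f₁ L φ T₀ TN (γ 0) ρ) ∧
    ∀ ρ : ℝ → Module.Dual ℝ (GroupLieAlgebra 𝓘(ℝ, E) G),
      LieSwitch.IsCostate f₁ L φ T₀ TN (γ 0) ρ →
        HasDerivWithinAt (fun lam => LieSwitch.cost L φ T₀ TN (γ lam))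
          (ρ τ₀ (f₂ (γ 0 τ₀) τ₀ - f₁ (γ 0 τ₀) τ₀)) (Ici 0) 0 := by
  have hnominal := hγ.self_of_nhdsWithin self_mem_Ici
  rw [LieSwitch.insertedMode_zero] at hnominal
  refine ⟨LieSwitch.exists_isCostate (hT₀.trans hTN.le) hf₁ hL hφ hnominal.cont, fun ρ hρ => ?_⟩
  let R : ℝ → E →L[ℝ] ℝ := fun t => LinearMap.toContinuousLinearMap (E := E) (ρ t)
  obtain ⟨hR, hRb⟩ := (LieSwitch.isCostate_iff_hasDerivWithinAt (R := R)
    (fun t ht => LieSwitch.mdifferentiable_left_of_contMDiffOn (V := E) hf₁ ht)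
    (hL.mdifferentiable one_ne_zero) hφ fun t v => rfl).1 hρ
  exact LieSwitch.hasDerivWithinAt_cost (E := E) (f₁ := f₁) (f₂ := f₂) hT₀ hTN hf₁ hf₂ hL hφ
    hnominal (hγ.filter_mono (nhdsWithin_mono _ Ioi_subset_Ici_self)) hR hRb

theorem corollary1 {E : Type*} [NormedAddCommGroup E] [NormedSpace ℝ E] [FiniteDimensional ℝ E]
    {G : Type*} [TopologicalSpace G] [ChartedSpace E G] [Group G]
    [LieGroup 𝓘(ℝ, E) ∞ G] [T2Space G]
    (f₁ f₂ : G → ℝ → GroupLieAlgebra 𝓘(ℝ, E) G) (L φ : G → ℝ)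
    (T₀ TN τ₀ : ℝ) (hT₀ : T₀ ≤ τ₀) (hTN : τ₀ < TN)
    (hf₁ : ContMDiffOn (M' := E) (𝓘(ℝ, E).prod 𝓘(ℝ, ℝ)) 𝓘(ℝ, E) 1
      (fun p : G × ℝ => f₁ p.1 p.2) (univ ×ˢ Icc T₀ TN))
    (hf₂ : ContMDiffOn (M' := E) (𝓘(ℝ, E).prod 𝓘(ℝ, ℝ)) 𝓘(ℝ, E) 1
      (fun p : G × ℝ => f₂ p.1 p.2) (univ ×ˢ Icc T₀ TN))
    (hL : ContMDiff 𝓘(ℝ, E) 𝓘(ℝ, ℝ) 1 L) (hφ : MDifferentiable 𝓘(ℝ, E) 𝓘(ℝ, ℝ) φ)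
    (g₀ : G) (γ : ℝ → ℝ → G)
    (hγ : ∀ᶠ lam in 𝓝[≥] (0 : ℝ),
      LieSwitch.IsTrajectory (LieSwitch.insertedMode f₁ f₂ τ₀ lam) T₀ TN g₀ (γ lam)) :
    (∃ ρ : ℝ → Module.Dual ℝ (GroupLieAlgebra 𝓘(ℝ, E) G),
      LieSwitch.IsCostate f₁ L φ T₀ TN (γ 0) ρ) ∧
    ∀ ρ : ℝ → Module.Dual ℝ (GroupLieAlgebra 𝓘(ℝ, E) G),
      LieSwitch.IsCostate f₁ L φ T₀ TN (γ 0) ρ →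
        HasDerivWithinAt (fun lam => LieSwitch.cost L φ T₀ TN (γ lam))
          (ρ τ₀ (f₂ (γ 0 τ₀) τ₀ - f₁ (γ 0 τ₀) τ₀)) (Ici 0) 0 :=
  corollary1_general f₁ f₂ L φ T₀ TN τ₀ hT₀ hTN hf₁ g₀ γ
    ((hf₂.continuousOn _ ⟨trivial, hT₀, hTN.le⟩).mono
      (prod_mono subset_rfl (Icc_subset_Icc_left hT₀))) hL (hφ _) hγ
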